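/- Let $G$ be a finite graph without loops (parallel edges are allowed; in particular $G$ may be any finite simple graph). Suppose that $G$ has at least $5$ vertices and is $3$-connected, i.e. $G$ remains connected after the deletion of any set of at most two vertices. Let $M(G)$ be the cycle matroid of $G$, the matroid on the edge set of $G$ whose circuits are the edge sets of the cycles of $G$, and let $B(G)$ be the bicircular matroid of $G$, the matroid on the edge set of $G$ whose circuits are the edge sets of the bicycles of $G$, i.e. of the subgraphs that are subdivisions of one of the following three graphs: two loops at the same vertex, two loops joined by an edge, or three edges joining the same two vertices. For a matroid $M$ on a finite ground set $E$, an automorphism is a bijection $\phi : E \to E$ such that $\phi(C)$ is a circuit if and only if $C$ is a circuit; a fixing set is a set $S \subseteq E$ such that the identity is the only automorphism fixing every element of $S$; and the fixing number $\mathrm{fix}(M)$ is the minimum size of a fixing set. Then $$\mathrm{fix}(M(G)) = \mathrm{fix}(B(G)).$$ -/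

import Mathlib

open Set

namespace Graph

variable {α β : Type*} {G : Graph α β}

/-- `G.IsPathBetween x y P F`: `P` is the vertex set and `F` the edge set of a path of `G` from `x`
to `y`, that is, of a walk that repeats no vertex. -/
inductive IsPathBetween (G : Graph α β) : α → α → Set α → Set β → Prop
  | nil {x : α} (hx : x ∈ G.vertexSet) : IsPathBetween G x x {x} ∅
  | cons {x y z : α} {e : β} {P : Set α} {F : Set β} (he : G.IsLink e x y)
      (hp : IsPathBetween G y z P F) (hx : x ∉ P) : IsPathBetween G x z (insert x P) (insert e F)

/-- `P` is the vertex set and `F` the edge set of a cycle of `G`: a path together with one more edge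
that joins its two ends. Loops and pairs of parallel edges are cycles of length 1 and 2. -/
def IsCycleOn (G : Graph α β) (P : Set α) (F : Set β) : Prop :=
  ∃ (x y : α) (F' : Set β) (e : β),
    G.IsPathBetween x y P F' ∧ G.IsLink e x y ∧ e ∉ F' ∧ F = insert e F'

/-- `C` is the edge set of a cycle of `G`. -/
def IsCycleEdgeSet (G : Graph α β) (C : Set β) : Prop := ∃ P, G.IsCycleOn P C

/-- Subdivision of three edges joining the same two vertices: three paths between two distinct
vertices that share nothing but their ends. -/
def IsTheta (G : Graph α β) (C : Set β) : Prop :=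
  ∃ (x y : α) (P₁ P₂ P₃ : Set α) (F₁ F₂ F₃ : Set β), x ≠ y ∧
    G.IsPathBetween x y P₁ F₁ ∧ G.IsPathBetween x y P₂ F₂ ∧ G.IsPathBetween x y P₃ F₃ ∧
    P₁ ∩ P₂ = {x, y} ∧ P₁ ∩ P₃ = {x, y} ∧ P₂ ∩ P₃ = {x, y} ∧
    Disjoint F₁ F₂ ∧ Disjoint F₁ F₃ ∧ Disjoint F₂ F₃ ∧ C = F₁ ∪ F₂ ∪ F₃

/-- Subdivision of two loops at the same vertex: two edge-disjoint cycles that share exactly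
one vertex. -/
def IsTightHandcuff (G : Graph α β) (C : Set β) : Prop :=
  ∃ (x : α) (P₁ P₂ : Set α) (F₁ F₂ : Set β),
    G.IsCycleOn P₁ F₁ ∧ G.IsCycleOn P₂ F₂ ∧ P₁ ∩ P₂ = {x} ∧ Disjoint F₁ F₂ ∧ C = F₁ ∪ F₂

/-- Subdivision of two loops joined by an edge: two vertex-disjoint cycles and a path from one
to the other that meets each of them only in its end. -/
def IsLooseHandcuff (G : Graph α β) (C : Set β) : Prop :=
  ∃ (x y : α) (P₁ P₂ P : Set α) (F₁ F₂ F : Set β),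
    G.IsCycleOn P₁ F₁ ∧ G.IsCycleOn P₂ F₂ ∧ Disjoint P₁ P₂ ∧
    G.IsPathBetween x y P F ∧ P ∩ P₁ = {x} ∧ P ∩ P₂ = {y} ∧ C = F₁ ∪ F₂ ∪ F

/-- `C` is the edge set of a bicycle of `G`. -/
def IsBicycle (G : Graph α β) (C : Set β) : Prop :=
  G.IsTheta C ∨ G.IsTightHandcuff C ∨ G.IsLooseHandcuff C

/-! ### Paths -/

namespace IsPathBetween

variable {x y z : α} {P Q : Set α} {F F' : Set β}

lemma left_mem (h : G.IsPathBetween x y P F) : x ∈ P := by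
  cases h <;> simp

lemma right_mem (h : G.IsPathBetween x y P F) : y ∈ P := by
  induction h with
  | nil => simp
  | cons _ _ _ ih => exact Or.inr ih

lemma finite (h : G.IsPathBetween x y P F) : P.Finite ∧ F.Finite := by
  induction h with
  | nil => simp
  | cons _ _ _ ih => exact ⟨ih.1.insert _, ih.2.insert _⟩

lemma ends (h : G.IsPathBetween x y P F) :
    ∀ e ∈ F, ∃ a b, G.IsLink e a b ∧ a ∈ P ∧ b ∈ P ∧ a ≠ b := by
  induction h with
  | nil => simp
  | @cons x y z e P F he hp hx ih =>
    rintro f (rfl | hf)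
    · exact ⟨x, y, he, Or.inl rfl, Or.inr hp.left_mem, fun h => hx (h ▸ hp.left_mem)⟩
    · obtain ⟨a, b, h, ha, hb, hab⟩ := ih f hf
      exact ⟨a, b, h, Or.inr ha, Or.inr hb, hab⟩

lemma inc_mem (h : G.IsPathBetween x y P F) {e : β} {a : α} (he : e ∈ F) (ha : G.Inc e a) :
    a ∈ P := by
  obtain ⟨u, v, huv, hu, hv, -⟩ := h.ends e he
  rcases ha.eq_or_eq_of_isLink huv with rfl | rfl <;> assumption

lemma subset_edgeSet (h : G.IsPathBetween x y P F) : F ⊆ G.edgeSet := fun e he => by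
  obtain ⟨u, v, huv, -⟩ := h.ends e he
  exact huv.edge_mem

lemma subset_vertexSet (h : G.IsPathBetween x y P F) : P ⊆ G.vertexSet := by
  induction h with
  | nil hx => simpa
  | cons he hp hx ih => exact insert_subset he.left_mem ih

lemma ncard (h : G.IsPathBetween x y P F) : P.ncard = F.ncard + 1 := by
  induction h with
  | nil => simp
  | @cons x y z e P F he hp hx ih =>
    rw [ncard_insert_of_notMem hx hp.finite.1, ncard_insert_of_notMem _ hp.finite.2, ih]
    exact fun h => hx (hp.inc_mem h he.inc_left)

lemma disjoint_of_inter_subset (h : G.IsPathBetween x y P F) {a : α}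
    (hF' : ∀ e ∈ F', ∀ v, G.Inc e v → v ∈ Q) (hPQ : P ∩ Q ⊆ {a}) : Disjoint F F' := by
  rw [Set.disjoint_left]
  intro e he he'
  obtain ⟨u, v, huv, hu, hv, hne⟩ := h.ends e he
  have h1 := hPQ ⟨hu, hF' e he' u huv.inc_left⟩
  have h2 := hPQ ⟨hv, hF' e he' v huv.inc_right⟩
  exact hne (h1.trans h2.symm)

lemma trans (h : G.IsPathBetween x y P F) (h' : G.IsPathBetween y z Q F') (hPQ : P ∩ Q ⊆ {y}) :
    G.IsPathBetween x z (P ∪ Q) (F ∪ F') := by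
  induction h with
  | @nil y hy =>
    have : {y} ∪ Q = Q := by
      rw [union_eq_right]; simpa using h'.left_mem
    rwa [this, empty_union]
  | @cons x w y e P F he hp hx ih =>
    rw [insert_union, insert_union]
    refine cons he (ih h' fun a ha => hPQ ⟨Or.inr ha.1, ha.2⟩) ?_
    rintro (h | h)
    · exact hx h
    · have := hPQ ⟨Or.inl rfl, h⟩
      exact hx (this ▸ hp.right_mem)

lemma single {e : β} (he : G.IsLink e x y) (hne : x ≠ y) : G.IsPathBetween x y {x, y} {e} := by
  have := cons he (nil he.right_mem) (by simpa using hne)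
  simpa using this

lemma symm (h : G.IsPathBetween x y P F) : G.IsPathBetween y x P F := by
  induction h with
  | nil hx => exact nil hx
  | @cons x w y e P F he hp hx ih =>
    have hne : w ≠ x := fun h => hx (h ▸ hp.left_mem)
    have := ih.trans (single he.symm hne) (by
      rintro a ⟨ha, rfl | rfl⟩
      · rfl
      · exact absurd ha hx)
    convert this using 1
    · ext a
      have := hp.left_mem
      simp only [mem_insert_iff, mem_union, mem_singleton_iff]
      constructor
      · rintro (h | h) <;> simp [h]
      · rintro (h | rfl | h) <;> simp_all
    · simp

lemma split (h : G.IsPathBetween x z P F) (hy : y ∈ P) :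
    ∃ P₁ F₁ P₂ F₂, G.IsPathBetween x y P₁ F₁ ∧ G.IsPathBetween y z P₂ F₂ ∧ P₁ ∪ P₂ = P ∧
      P₁ ∩ P₂ = {y} ∧ F₁ ∪ F₂ = F ∧ Disjoint F₁ F₂ := by
  induction h with
  | @nil x hx =>
    obtain rfl : y = x := hy
    exact ⟨_, _, _, _, nil hx, nil hx, by simp, by simp, by simp, by simp⟩
  | @cons x w z e P F he hp hx ih =>
    by_cases hyx : y = x
    · subst hyx
      exact ⟨_, _, _, _, nil he.left_mem, cons he hp hx, by simp, by simp, by simp, by simp⟩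
    · obtain ⟨P₁, F₁, P₂, F₂, h1, h2, hP, hP', hF, hF'⟩ := ih (hy.resolve_left hyx)
      have hx1 : x ∉ P₁ := fun h => hx (hP ▸ Or.inl h)
      have hx2 : x ∉ P₂ := fun h => hx (hP ▸ Or.inr h)
      refine ⟨_, _, P₂, F₂, cons he h1 hx1, h2, ?_, ?_, ?_, ?_⟩
      · rw [insert_union, hP]
      · rw [insert_inter_of_notMem hx2, hP']
      · rw [insert_union, hF]
      · rw [disjoint_insert_left]
        exact ⟨fun h => hx2 (h2.inc_mem h he.inc_left), hF'⟩

/-- At the first vertex of a path there is at most one edge of the path. -/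
lemma head_unique (h : G.IsPathBetween x y P F) {e f : β} (he : e ∈ F) (hf : f ∈ F)
    (hex : G.Inc e x) (hfx : G.Inc f x) : e = f := by
  cases h with
  | nil => exact absurd he (by simp)
  | cons h hp hx =>
    rcases he with rfl | he
    · rcases hf with rfl | hf
      · rfl
      · exact absurd (hp.inc_mem hf hfx) hx
    · exact absurd (hp.inc_mem he hex) hx

end IsPathBetween

/-! ### Cycles -/

namespace IsCycleOn

variable {P : Set α} {F : Set β}

lemma finite (h : G.IsCycleOn P F) : P.Finite ∧ F.Finite := by
  obtain ⟨x, y, F', e, hp, he, hF, rfl⟩ := h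
  exact ⟨hp.finite.1, hp.finite.2.insert _⟩

lemma inc_mem (h : G.IsCycleOn P F) {e : β} {a : α} (he : e ∈ F) (ha : G.Inc e a) : a ∈ P := by
  obtain ⟨x, y, F', f, hp, hf, hF, rfl⟩ := h
  rcases he with rfl | he
  · rcases ha.eq_or_eq_of_isLink hf with rfl | rfl
    exacts [hp.left_mem, hp.right_mem]
  · exact hp.inc_mem he ha

lemma subset_edgeSet (h : G.IsCycleOn P F) : F ⊆ G.edgeSet := by
  obtain ⟨x, y, F', f, hp, hf, hF, rfl⟩ := h
  exact insert_subset hf.edge_mem hp.subset_edgeSet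

lemma subset_vertexSet (h : G.IsCycleOn P F) : P ⊆ G.vertexSet := by
  obtain ⟨x, y, F', f, hp, hf, hF, rfl⟩ := h
  exact hp.subset_vertexSet

lemma ncard (h : G.IsCycleOn P F) : P.ncard = F.ncard := by
  obtain ⟨x, y, F', f, hp, hf, hF, rfl⟩ := h
  rw [ncard_insert_of_notMem hF hp.finite.2, hp.ncard]

lemma nonempty (h : G.IsCycleOn P F) : F.Nonempty := by
  obtain ⟨x, y, F', f, hp, hf, hF, rfl⟩ := h
  exact insert_nonempty _ _

lemma split_aux {x y a b : α} {A B C : Set α} {FA FB FC : Set β} {e : β}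
    (hA : G.IsPathBetween x a A FA) (hB : G.IsPathBetween a b B FB) (hC : G.IsPathBetween b y C FC)
    (hAB : A ∩ B = {a}) (hBC : B ∩ C = {b}) (hAC : Disjoint A C)
    (hFAB : Disjoint FA FB) (hFBC : Disjoint FB FC) (he : G.IsLink e x y) (heB : e ∉ FB) :
    ∃ P₁ F₁ P₂ F₂, G.IsPathBetween a b P₁ F₁ ∧ G.IsPathBetween a b P₂ F₂ ∧
      P₁ ∩ P₂ = {a, b} ∧ P₁ ∪ P₂ = A ∪ B ∪ C ∧ Disjoint F₁ F₂ ∧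
      F₁ ∪ F₂ = insert e (FA ∪ FB ∪ FC) := by
  have hy : y ∉ A := fun h => Set.disjoint_left.1 hAC h hC.right_mem
  have h1 := IsPathBetween.cons he.symm hA hy
  have h2 := hC.trans h1 (by
    rintro v ⟨hv, rfl | hv'⟩
    · rfl
    · exact absurd hv (Set.disjoint_left.1 hAC hv'))
  refine ⟨_, _, _, _, hB, h2.symm, ?_, ?_, ?_, ?_⟩
  · have haC : a ∉ C := Set.disjoint_left.1 hAC hA.right_mem
    have hyC := hC.right_mem
    rw [inter_union_distrib_left, hBC, union_comm, ← union_singleton, inter_union_distrib_left,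
      inter_comm B A, hAB]
    ext v
    simp only [mem_union, mem_inter_iff, mem_singleton_iff, mem_insert_iff]
    constructor
    · rintro ((h | ⟨h, rfl⟩) | h)
      · exact Or.inl h
      · have : v ∈ B ∩ C := ⟨h, hyC⟩
        rw [hBC] at this
        exact Or.inr this
      · exact Or.inr h
    · rintro (h | h) <;> simp [h]
  · ext v
    have hyC := hC.right_mem
    simp only [mem_union, mem_insert_iff]
    constructor
    · rintro (h | h | rfl | h) <;> simp_all
    · rintro ((h | h) | h) <;> simp_all
  · rw [disjoint_union_right, disjoint_insert_right]
    exact ⟨hFBC, heB, hFAB.symm⟩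
  · ext v
    simp only [mem_union, mem_insert_iff]
    tauto

/-- Two distinct vertices divide a cycle into two paths. -/
lemma split (h : G.IsCycleOn P F) {a b : α} (ha : a ∈ P) (hb : b ∈ P) (hab : a ≠ b) :
    ∃ P₁ F₁ P₂ F₂, G.IsPathBetween a b P₁ F₁ ∧ G.IsPathBetween a b P₂ F₂ ∧
      P₁ ∩ P₂ = {a, b} ∧ P₁ ∪ P₂ = P ∧ Disjoint F₁ F₂ ∧ F₁ ∪ F₂ = F := by
  obtain ⟨x, y, F', e, hp, he, hF, rfl⟩ := h
  obtain ⟨P₁, F₁, P₂, F₂, h1, h2, rfl, hP, rfl, hF12⟩ := hp.split ha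
  have hF1 : e ∉ F₁ := fun h => hF (Or.inl h)
  have hF2 : e ∉ F₂ := fun h => hF (Or.inr h)
  rcases hb with hb | hb
  · obtain ⟨Q₁, E₁, Q₂, E₂, g1, g2, rfl, hQ, rfl, hE⟩ := h1.split hb
    have haQ : a ∉ Q₁ := fun h => hab (by
      have : a ∈ Q₁ ∩ Q₂ := ⟨h, g2.right_mem⟩
      rwa [hQ] at this)
    have hd : Disjoint Q₁ P₂ := by
      rw [Set.disjoint_left]
      intro v hv hv'
      have : v ∈ (Q₁ ∪ Q₂) ∩ P₂ := ⟨Or.inl hv, hv'⟩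
      rw [hP] at this
      exact haQ (this ▸ hv)
    have hd' : Q₂ ∩ P₂ = {a} := by
      refine Subset.antisymm (fun v hv => ?_) ?_
      · rw [← hP]; exact ⟨Or.inr hv.1, hv.2⟩
      · simpa using ⟨g2.right_mem, h2.left_mem⟩
    rw [disjoint_union_left] at hF12
    obtain ⟨A, FA, B, FB, k1, k2, k3, k4, k5, k6⟩ :=
      split_aux g1 g2 h2 hQ hd' hd hE hF12.2 he fun h => hF1 (Or.inr h)
    exact ⟨A, FA, B, FB, k1.symm, k2.symm, by rw [k3, pair_comm], k4, k5, k6⟩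
  · obtain ⟨Q₁, E₁, Q₂, E₂, g1, g2, rfl, hQ, rfl, hE⟩ := h2.split hb
    have haQ : a ∉ Q₂ := fun h => hab (by
      have : a ∈ Q₁ ∩ Q₂ := ⟨g1.left_mem, h⟩
      rwa [hQ] at this)
    have hd : Disjoint P₁ Q₂ := by
      rw [Set.disjoint_left]
      intro v hv hv'
      have : v ∈ P₁ ∩ (Q₁ ∪ Q₂) := ⟨hv, Or.inr hv'⟩
      rw [hP] at this
      exact haQ (this ▸ hv')
    have hd' : P₁ ∩ Q₁ = {a} := by
      refine Subset.antisymm (fun v hv => ?_) ?_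
      · rw [← hP]; exact ⟨hv.1, Or.inl hv.2⟩
      · simpa using ⟨h1.right_mem, g1.left_mem⟩
    rw [disjoint_union_right] at hF12
    obtain ⟨A, FA, B, FB, k1, k2, k3, k4, k5, k6⟩ :=
      split_aux h1 g1 g2 hd' hQ hd hF12.1 hE he fun h => hF2 (Or.inl h)
    exact ⟨A, FA, B, FB, k1, k2, k3, by rw [k4, union_assoc], k5, by rw [k6, union_assoc]⟩

end IsCycleOn

/-- A path followed by an edge from its first vertex back to one of its vertices contains a
cycle. -/
lemma IsPathBetween.exists_isCycleOn {x y z : α} {P : Set α} {F : Set β} {f : β}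
    (h : G.IsPathBetween x z P F) (hf : G.IsLink f x y) (hfF : f ∉ F) (hy : y ∈ P) :
    ∃ P₁ F₁ P₂ F₂, G.IsCycleOn P₁ (insert f F₁) ∧ G.IsPathBetween y z P₂ F₂ ∧
      P₁ ∪ P₂ = P ∧ P₁ ∩ P₂ = {y} ∧ F₁ ∪ F₂ = F := by
  obtain ⟨P₁, F₁, P₂, F₂, h1, h2, hP, hP', hF, hF'⟩ := h.split hy
  exact ⟨P₁, F₁, P₂, F₂, ⟨x, y, F₁, f, h1, hf, fun h => hfF (hF ▸ Or.inl h), rfl⟩, h2, hP, hP', hF⟩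

/-- A nonempty finite edge set without vertices of degree one contains a cycle. -/
lemma exists_isCycleOn_subset {J : Set β} (hJ : J.Finite) (hne : J.Nonempty) (hJE : J ⊆ G.edgeSet)
    (hdeg : ∀ e ∈ J, ∀ x, G.Inc e x → ∃ f ∈ J, f ≠ e ∧ G.Inc f x) :
    ∃ P F, G.IsCycleOn P F ∧ F ⊆ J := by
  classical
  by_contra! hcon
  have key : ∀ n : ℕ, ∃ x z P F, G.IsPathBetween x z P F ∧ F ⊆ J ∧ F.ncard = n + 1 := by
    intro n
    induction n with
    | zero =>
      obtain ⟨e, he⟩ := hne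
      obtain ⟨x, y, hxy⟩ := exists_isLink_of_mem_edgeSet (hJE he)
      by_cases h : x = y
      · subst h
        exact absurd (singleton_subset_iff.2 he) (hcon {x} {e}
          ⟨x, x, ∅, e, .nil hxy.left_mem, hxy, by simp, by simp⟩)
      · exact ⟨x, y, _, _, .single hxy h, by simpa, by simp⟩
    | succ n ih =>
      obtain ⟨x, z, P, F, h, hFJ, hn⟩ := ih
      cases h with
      | nil => simp at hn
      | @cons _ w _ e P F he hp hx =>
        obtain ⟨f, hfJ, hfe, y, hy⟩ := hdeg e (hFJ (Or.inl rfl)) x he.inc_left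
        have hpath := IsPathBetween.cons he hp hx
        have hfF : f ∉ insert e F := fun h =>
          hfe (hpath.head_unique h (Or.inl rfl) hy.inc_left he.inc_left)
        by_cases hyP : y ∈ insert x P
        · obtain ⟨P₁, F₁, P₂, F₂, hc, -, -, -, hF⟩ := hpath.exists_isCycleOn hy hfF hyP
          refine absurd (insert_subset hfJ fun g hg => hFJ ?_) (hcon _ _ hc)
          rw [← hF]; exact Or.inl hg
        · refine ⟨y, z, _, _, .cons hy.symm hpath hyP, insert_subset hfJ hFJ, ?_⟩
          rw [ncard_insert_of_notMem hfF hpath.finite.2, hn]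
  obtain ⟨x, z, P, F, -, hF, hn⟩ := key J.ncard
  have := ncard_le_ncard hF hJ
  omega

/-! ### Bicycles -/

/-- The set of ends of the edges in `J`. -/
def endSet (G : Graph α β) (J : Set β) : Set α := {x | ∃ e ∈ J, G.Inc e x}

lemma endSet_mono {J K : Set β} (h : J ⊆ K) : G.endSet J ⊆ G.endSet K :=
  fun _ ⟨e, he, hx⟩ => ⟨e, h he, hx⟩

lemma endSet_union (J K : Set β) : G.endSet (J ∪ K) = G.endSet J ∪ G.endSet K := by
  ext x
  simp only [endSet, mem_ofPred_eq, mem_union, or_and_right, exists_or]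

lemma finite_endSet {J : Set β} (hJ : J.Finite) : (G.endSet J).Finite := by
  have : G.endSet J = ⋃ e ∈ J, {x | G.Inc e x} := by ext; simp [endSet]
  rw [this]
  refine hJ.biUnion fun e _ => ?_
  by_cases he : e ∈ G.edgeSet
  · obtain ⟨x, y, h⟩ := exists_isLink_of_mem_edgeSet he
    exact (Set.toFinite {x, y}).subset fun v hv => hv.eq_or_eq_of_isLink h
  · simp [not_inc_of_notMem_edgeSet he]

lemma IsBicycle.spec {C : Set β} (h : G.IsBicycle C) :
    C.Finite ∧ C ⊆ G.edgeSet ∧ (G.endSet C).ncard < C.ncard := by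
  obtain h | h | h := h
  · obtain ⟨x, y, P₁, P₂, P₃, F₁, F₂, F₃, hxy, h1, h2, h3, h12, h13, h23, d12, d13, d23, rfl⟩ := h
    have f1 := h1.finite
    have f2 := h2.finite
    have f3 := h3.finite
    refine ⟨(f1.2.union f2.2).union f3.2, union_subset (union_subset h1.subset_edgeSet
      h2.subset_edgeSet) h3.subset_edgeSet, ?_⟩
    have hs : G.endSet (F₁ ∪ F₂ ∪ F₃) ⊆ P₁ ∪ P₂ ∪ P₃ := by
      rintro v ⟨e, (he | he) | he, hv⟩
      exacts [Or.inl (Or.inl (h1.inc_mem he hv)), Or.inl (Or.inr (h2.inc_mem he hv)),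
        Or.inr (h3.inc_mem he hv)]
    have hs' := ncard_le_ncard hs ((f1.1.union f2.1).union f3.1)
    have e1 := ncard_union_add_ncard_inter P₁ P₂ f1.1 f2.1
    have e2 := ncard_union_add_ncard_inter (P₁ ∪ P₂) P₃ (f1.1.union f2.1) f3.1
    rw [union_inter_distrib_right, h13, h23, union_self, ncard_pair hxy] at e2
    rw [h12, ncard_pair hxy] at e1
    rw [ncard_union_eq (by simp [d13, d23]) (f1.2.union f2.2) f3.2, ncard_union_eq d12 f1.2 f2.2]
    have := h1.ncard
    have := h2.ncard
    have := h3.ncard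
    omega
  · obtain ⟨x, P₁, P₂, F₁, F₂, h1, h2, hP, hd, rfl⟩ := h
    have f1 := h1.finite
    have f2 := h2.finite
    refine ⟨f1.2.union f2.2, union_subset h1.subset_edgeSet h2.subset_edgeSet, ?_⟩
    have hs : G.endSet (F₁ ∪ F₂) ⊆ P₁ ∪ P₂ := by
      rintro v ⟨e, he | he, hv⟩
      exacts [Or.inl (h1.inc_mem he hv), Or.inr (h2.inc_mem he hv)]
    have hs' := ncard_le_ncard hs (f1.1.union f2.1)
    have e1 := ncard_union_add_ncard_inter P₁ P₂ f1.1 f2.1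
    rw [hP, ncard_singleton] at e1
    rw [ncard_union_eq hd f1.2 f2.2]
    have := h1.ncard
    have := h2.ncard
    omega
  · obtain ⟨x, y, P₁, P₂, P, F₁, F₂, F, h1, h2, hP, h, hx, hy, rfl⟩ := h
    have f1 := h1.finite
    have f2 := h2.finite
    have f := h.finite
    refine ⟨(f1.2.union f2.2).union f.2, union_subset (union_subset h1.subset_edgeSet
      h2.subset_edgeSet) h.subset_edgeSet, ?_⟩
    have hs : G.endSet (F₁ ∪ F₂ ∪ F) ⊆ P₁ ∪ P₂ ∪ P := by
      rintro v ⟨e, (he | he) | he, hv⟩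
      exacts [Or.inl (Or.inl (h1.inc_mem he hv)), Or.inl (Or.inr (h2.inc_mem he hv)),
        Or.inr (h.inc_mem he hv)]
    have hs' := ncard_le_ncard hs ((f1.1.union f2.1).union f.1)
    have hxy : x ≠ y := by
      rintro rfl
      have h1' : x ∈ P ∩ P₁ := hx ▸ rfl
      have h2' : x ∈ P ∩ P₂ := hy ▸ rfl
      exact Set.disjoint_left.1 hP h1'.2 h2'.2
    have d1 : Disjoint F F₁ := h.disjoint_of_inter_subset (fun e he v hv => h1.inc_mem he hv) hx.le
    have d2 : Disjoint F F₂ := h.disjoint_of_inter_subset (fun e he v hv => h2.inc_mem he hv) hy.le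
    have d12 : Disjoint F₁ F₂ := by
      rw [Set.disjoint_left]
      intro e he he'
      obtain ⟨u, v, huv⟩ := exists_isLink_of_mem_edgeSet (h1.subset_edgeSet he)
      exact Set.disjoint_left.1 hP (h1.inc_mem he huv.inc_left) (h2.inc_mem he' huv.inc_left)
    have e1 := ncard_union_eq hP f1.1 f2.1
    have e2 := ncard_union_add_ncard_inter (P₁ ∪ P₂) P (f1.1.union f2.1) f.1
    rw [union_inter_distrib_right, inter_comm P₁, inter_comm P₂, hx, hy, singleton_union,
      ncard_pair hxy] at e2
    rw [ncard_union_eq (by simp [d1.symm, d2.symm]) (f1.2.union f2.2) f.2,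
      ncard_union_eq d12 f1.2 f2.2]
    have := h1.ncard
    have := h2.ncard
    have := h.ncard
    omega

/-- A finite edge set with more edges than ends contains a bicycle. -/
lemma exists_isBicycle_subset {J : Set β} (hJ : J.Finite) (hJE : J ⊆ G.edgeSet)
    (hcard : (G.endSet J).ncard < J.ncard) : ∃ C ⊆ J, G.IsBicycle C := by
  classical
  induction hn : J.ncard using Nat.strong_induction_on generalizing J with
  | _ n ih =>
  subst hn
  -- no vertex has degree one
  by_cases hdeg : ∀ e ∈ J, ∀ x, G.Inc e x → ∃ f ∈ J, f ≠ e ∧ G.Inc f x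
  swap
  · push Not at hdeg
    obtain ⟨e, he, x, hex, hall⟩ := hdeg
    have hlt : (J \ {e}).ncard < J.ncard := ncard_sdiff_singleton_lt_of_mem he hJ
    have hlt' : (G.endSet (J \ {e})).ncard < (G.endSet J).ncard := by
      refine ncard_lt_ncard ⟨endSet_mono sdiff_subset, fun h => ?_⟩ (finite_endSet hJ)
      obtain ⟨f, hf, hfx⟩ := h ⟨e, he, hex⟩
      exact hall f hf.1 hf.2 hfx
    have := ncard_sdiff_singleton_add_one he hJ
    obtain ⟨C, hC, hC'⟩ := ih _ hlt (hJ.subset sdiff_subset) (sdiff_subset.trans hJE)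
      (by omega) rfl
    exact ⟨C, hC.trans sdiff_subset, hC'⟩
  have hne : J.Nonempty := nonempty_of_ncard_ne_zero (by omega)
  obtain ⟨Pc, Fc, hc, hcJ⟩ := exists_isCycleOn_subset hJ hne hJE hdeg
  have hPc : Pc ⊆ G.endSet J := by
    obtain ⟨x, y, F', e, hp, he, hF, rfl⟩ := hc
    have aux : ∀ {a b P F}, G.IsPathBetween a b P F → a ∈ G.endSet J → F ⊆ J → P ⊆ G.endSet J := by
      intro a b P F h
      induction h with
      | nil => intro h _; simpa using h
      | cons he hp hx ih =>
        intro h hF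
        exact insert_subset h (ih ⟨_, hF (Or.inl rfl), he.inc_right⟩
          fun f hf => hF (Or.inr hf))
    exact aux hp ⟨e, hcJ (Or.inl rfl), he.inc_left⟩ fun f hf => hcJ (Or.inr hf)
  by_cases hout : ∃ e ∈ J, e ∉ Fc ∧ ∃ a ∈ Pc, G.Inc e a
  swap
  · push Not at hout
    have hlt : (J \ Fc).ncard + Fc.ncard = J.ncard := ncard_sdiff_add_ncard_of_subset hcJ hJ
    have hsub : G.endSet (J \ Fc) ⊆ G.endSet J \ Pc := by
      rintro v ⟨e, he, hv⟩
      exact ⟨⟨e, he.1, hv⟩, fun h => hout e he.1 he.2 v h hv⟩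
    have h1 := ncard_le_ncard hsub ((finite_endSet hJ).subset sdiff_subset)
    have h2 := ncard_sdiff_add_ncard_of_subset hPc (finite_endSet hJ)
    have h3 := hc.ncard
    have h4 : 0 < Fc.ncard := (ncard_pos hc.finite.2).2 hc.nonempty
    obtain ⟨C, hC, hC'⟩ := ih (J \ Fc).ncard (by omega) (hJ.subset sdiff_subset) (sdiff_subset.trans hJE)
      (by omega) rfl
    exact ⟨C, hC.trans sdiff_subset, hC'⟩
  obtain ⟨e₀, he₀J, he₀F, a, ha, b, hab⟩ := hout
  -- an ear: a path in `J` between two vertices of the cycle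
  have ear : ∀ {y P F}, G.IsPathBetween y a P F → F ⊆ J → y ∈ Pc → y ≠ a → P ∩ Pc ⊆ {y, a} →
      Disjoint F Fc → ∃ C ⊆ J, G.IsBicycle C := by
    intro y P F hp hFJ hy hya hP hF
    obtain ⟨P₁, F₁, P₂, F₂, h1, h2, h12, hPU, hd, hFU⟩ := hc.split hy ha hya
    have aux : ∀ {Q E}, G.IsPathBetween y a Q E → Q ⊆ Pc → Q ∩ P = {y, a} := by
      intro Q E hQ hQP
      refine Subset.antisymm (fun v hv => hP ⟨hv.2, hQP hv.1⟩) ?_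
      rintro v (rfl | rfl)
      exacts [⟨hQ.left_mem, hp.left_mem⟩, ⟨hQ.right_mem, hp.right_mem⟩]
    rw [← hFU, disjoint_union_right] at hF
    refine ⟨F₁ ∪ F₂ ∪ F, union_subset (hFU ▸ hcJ) hFJ, Or.inl ⟨y, a, P₁, P₂, P, F₁, F₂, F, hya,
      h1, h2, hp, h12, aux h1 (hPU ▸ subset_union_left), aux h2 (hPU ▸ subset_union_right),
      hd, hF.1.symm, hF.2.symm, rfl⟩⟩
  by_cases hbPc : b ∈ Pc
  · by_cases hba : b = a
    · subst hba
      have hloop : G.IsCycleOn {b} {e₀} := ⟨b, b, ∅, e₀, .nil hab.left_mem, hab, by simp, by simp⟩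
      exact ⟨Fc ∪ {e₀}, union_subset hcJ (by simpa), Or.inr (Or.inl ⟨b, Pc, {b}, Fc, {e₀}, hc,
        hloop, by simpa, by simpa, rfl⟩)⟩
    · exact ear (IsPathBetween.single hab.symm hba) (by simpa) hbPc hba inter_subset_left
        (by simpa)
  by_contra! hcon
  have key : ∀ n : ℕ, ∃ w P F, G.IsPathBetween w a P F ∧ w ≠ a ∧ F ⊆ J ∧ P ∩ Pc ⊆ {a} ∧
      F.ncard = n + 1 := by
    intro n
    induction n with
    | zero =>
      have hba : b ≠ a := fun h => hbPc (h ▸ ha)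
      refine ⟨b, _, _, .single hab.symm hba, hba, by simpa, ?_, by simp⟩
      rintro v ⟨rfl | h, hv⟩
      exacts [absurd hv hbPc, h]
    | succ n ihn =>
      obtain ⟨w, P, F, hpath, hwa, hFJ, hPPc, hcardF⟩ := ihn
      have hpath' := hpath
      cases hpath with
      | nil => simp at hwa
      | @cons _ u _ e P F he hp hx =>
        obtain ⟨f, hfJ, hfe, y, hy⟩ := hdeg e (hFJ (Or.inl rfl)) w he.inc_left
        have hfF : f ∉ insert e F := fun h =>
          hfe (hpath'.head_unique h (Or.inl rfl) hy.inc_left he.inc_left)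
        have hwPc : w ∉ Pc := fun h => hwa (hPPc ⟨Or.inl rfl, h⟩)
        have hfFc : f ∉ Fc := fun h => hwPc (hc.inc_mem h hy.inc_left)
        have hFd : Disjoint (insert e F) Fc :=
          hpath'.disjoint_of_inter_subset (fun e he v hv => hc.inc_mem he hv) hPPc
        by_cases hyP : y ∈ insert w P
        · exfalso
          obtain ⟨P₁, F₁, P₂, F₂, hc₁, hp₂, hPU, hPI, hFU⟩ := hpath'.exists_isCycleOn hy hfF hyP
          have hF₁ : insert f F₁ ⊆ J := insert_subset hfJ fun g hg => hFJ (hFU ▸ Or.inl hg)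
          have hF₁d : Disjoint Fc (insert f F₁) := by
            rw [disjoint_insert_right]
            exact ⟨hfFc, (hFd.mono_left (hFU ▸ subset_union_left)).symm⟩
          by_cases hya : y = a
          · subst hya
            refine hcon (Fc ∪ insert f F₁) (union_subset hcJ hF₁)
              (Or.inr (Or.inl ⟨y, Pc, P₁, Fc, _, hc, hc₁, ?_, hF₁d, rfl⟩))
            refine Subset.antisymm (fun v hv => hPPc ⟨hPU ▸ Or.inl hv.2, hv.1⟩) ?_
            have : y ∈ P₁ ∩ P₂ := hPI ▸ rfl
            simpa using ⟨ha, this.1⟩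
          · have haP₁ : a ∉ P₁ := fun h => hya (by
              have : a ∈ P₁ ∩ P₂ := ⟨h, hp₂.right_mem⟩
              rw [hPI] at this
              exact this.symm)
            refine hcon (insert f F₁ ∪ Fc ∪ F₂) (union_subset (union_subset hF₁ hcJ)
              fun g hg => hFJ (hFU ▸ Or.inr hg)) (Or.inr (Or.inr ⟨y, a, P₁, Pc, P₂, _, Fc, F₂,
                hc₁, hc, ?_, hp₂, ?_, ?_, rfl⟩))
            · rw [Set.disjoint_left]
              intro v hv hv'
              have : v = a := hPPc ⟨hPU ▸ Or.inl hv, hv'⟩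
              exact haP₁ (this ▸ hv)
            · rw [inter_comm, hPI]
            · refine Subset.antisymm (fun v hv => hPPc ⟨hPU ▸ Or.inr hv.1, hv.2⟩) ?_
              simpa using ⟨hp₂.right_mem, ha⟩
        · have hpath'' := IsPathBetween.cons hy.symm hpath' hyP
          have hFJ' : insert f (insert e F) ⊆ J := insert_subset hfJ hFJ
          have hya : y ≠ a := fun h => hyP (h ▸ hpath'.right_mem)
          by_cases hyPc : y ∈ Pc
          · exfalso
            obtain ⟨C, hC, hC'⟩ := ear hpath'' hFJ' hyPc hya (by
              rintro v ⟨rfl | hv, hv'⟩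
              · exact Or.inl rfl
              · exact Or.inr (hPPc ⟨hv, hv'⟩)) (by
              rw [disjoint_insert_left]; exact ⟨hfFc, hFd⟩)
            exact hcon C hC hC'
          · refine ⟨y, _, _, hpath'', hya, hFJ', ?_, ?_⟩
            · rintro v ⟨rfl | hv, hv'⟩
              · exact absurd hv' hyPc
              · exact hPPc ⟨hv, hv'⟩
            · rw [ncard_insert_of_notMem hfF hpath'.finite.2, hcardF]
  obtain ⟨w, P, F, -, -, hF, -, hn⟩ := key J.ncard
  have := ncard_le_ncard hF hJ
  omega

/-! ### No circuit contains another -/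

/-- The edges in `K` can be assigned distinct ends, all of them in `W`. -/
def Assign (G : Graph α β) (K : Set β) (W : Set α) : Prop :=
  ∃ f : β → α, InjOn f K ∧ ∀ e ∈ K, G.Inc e (f e) ∧ f e ∈ W

lemma Assign.mono {K K' : Set β} {W W' : Set α} (h : Assign G K W) (hK : K' ⊆ K)
    (hW : W ⊆ W') : Assign G K' W' := by
  obtain ⟨f, hf, h⟩ := h
  exact ⟨f, hf.mono hK, fun e he => ⟨(h e (hK he)).1, hW (h e (hK he)).2⟩⟩

lemma Assign.union {K K' : Set β} {W W' : Set α} (h : Assign G K W)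
    (h' : Assign G K' W') (hd : Disjoint W W') : Assign G (K ∪ K') (W ∪ W') := by
  classical
  obtain ⟨f, hf, h⟩ := h
  obtain ⟨f', hf', h'⟩ := h'
  refine ⟨fun e => if e ∈ K then f e else f' e, ?_, ?_⟩
  · intro a ha b hb hab
    by_cases haK : a ∈ K <;> by_cases hbK : b ∈ K
    · simp only [haK, hbK, if_true] at hab
      exact hf haK hbK hab
    · simp only [haK, hbK, if_true, if_false] at hab
      exact absurd (h' b (hb.resolve_left hbK)).2
        (Set.disjoint_left.1 hd (hab ▸ (h a haK).2))
    · simp only [haK, hbK, if_true, if_false] at hab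
      exact absurd (h' a (ha.resolve_left haK)).2
        (Set.disjoint_left.1 hd (hab ▸ (h b hbK).2))
    · simp only [haK, hbK, if_false] at hab
      exact hf' (ha.resolve_left haK) (hb.resolve_left hbK) hab
  · intro e he
    by_cases heK : e ∈ K
    · simp only [heK, if_true]
      exact ⟨(h e heK).1, Or.inl (h e heK).2⟩
    · simp only [heK, if_false]
      have := h' e (he.resolve_left heK)
      exact ⟨this.1, Or.inr this.2⟩

lemma Assign.empty (W : Set α) (hne : Nonempty α) : Assign G ∅ W :=
  ⟨fun _ => hne.some, by simp, by simp⟩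

lemma Assign.singleton {e : β} {x : α} (h : G.Inc e x) : Assign G {e} {x} :=
  ⟨fun _ => x, by simp, by simpa⟩

lemma Assign.ncard_le {K : Set β} {W : Set α} (h : Assign G K W) (hK : K.Finite) :
    K.ncard ≤ (G.endSet K ∩ W).ncard := by
  obtain ⟨f, hf, h⟩ := h
  exact ncard_le_ncard_of_injOn f (fun e he => ⟨⟨e, he, (h e he).1⟩, (h e he).2⟩) hf
    ((finite_endSet hK).subset inter_subset_left)

lemma IsPathBetween.assign_right {x y : α} {P : Set α} {F : Set β}
    (h : G.IsPathBetween x y P F) : Assign G F (P \ {y}) := by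
  induction h with
  | @nil x _ => exact Assign.empty _ ⟨x⟩
  | @cons x w y e P F he hp hx ih =>
    refine (Assign.union (Assign.singleton he.inc_left) ih
      (by simpa using fun h => absurd h hx)).mono (by simp) ?_
    rintro v (rfl | hv)
    · exact ⟨Or.inl rfl, fun h => hx (h ▸ hp.right_mem)⟩
    · exact ⟨Or.inr hv.1, hv.2⟩

lemma IsPathBetween.assign {x y z : α} {P : Set α} {F : Set β}
    (h : G.IsPathBetween x y P F) (hz : z ∈ P) : Assign G F (P \ {z}) := by
  obtain ⟨P₁, F₁, P₂, F₂, h1, h2, rfl, hP, rfl, -⟩ := h.split hz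
  refine (h1.assign_right.union h2.symm.assign_right ?_).mono le_rfl (by simp [union_sdiff_distrib])
  rw [Set.disjoint_left]
  intro v hv hv'
  have : v ∈ P₁ ∩ P₂ := ⟨hv.1, hv'.1⟩
  rw [hP] at this
  exact hv.2 this

lemma IsPathBetween.split_edge {x y : α} {P : Set α} {F : Set β} {e : β}
    (h : G.IsPathBetween x y P F) (he : e ∈ F) :
    ∃ u v P₁ F₁ P₂ F₂, G.IsPathBetween x u P₁ F₁ ∧ G.IsLink e u v ∧ G.IsPathBetween v y P₂ F₂ ∧
      P₁ ∪ P₂ = P ∧ Disjoint P₁ P₂ ∧ F₁ ∪ F₂ = F \ {e} := by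
  induction h with
  | nil => simp at he
  | @cons x w y f P F hf hp hx ih =>
    have hfF : f ∉ F := fun h => hx (hp.inc_mem h hf.inc_left)
    by_cases hef : e = f
    · subst hef
      exact ⟨x, w, _, _, P, F, .nil hf.left_mem, hf, hp, by simp, by simpa, by simp [hfF]⟩
    · obtain ⟨u, v, P₁, F₁, P₂, F₂, h1, huv, h2, hP, hd, hF⟩ := ih (he.resolve_left hef)
      refine ⟨u, v, _, _, P₂, F₂, .cons hf h1 fun h => hx (hP ▸ Or.inl h), huv, h2, ?_, ?_, ?_⟩
      · rw [insert_union, hP]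
      · rw [disjoint_insert_left]
        exact ⟨fun h => hx (hP ▸ Or.inr h), hd⟩
      · rw [insert_union, hF]
        ext g
        simp only [mem_insert_iff, mem_sdiff, mem_singleton_iff]
        constructor
        · rintro (rfl | h)
          · exact ⟨Or.inl rfl, fun h => hef h.symm⟩
          · exact ⟨Or.inr h.1, h.2⟩
        · rintro ⟨h | h, h'⟩
          exacts [Or.inl h, Or.inr ⟨h, h'⟩]

lemma IsPathBetween.assign_diff {x y : α} {P : Set α} {F : Set β} {e : β}
    (h : G.IsPathBetween x y P F) (he : e ∈ F) : Assign G (F \ {e}) (P \ {x, y}) := by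
  obtain ⟨u, v, P₁, F₁, P₂, F₂, h1, -, h2, rfl, hd, hF⟩ := h.split_edge he
  rw [← hF]
  have hx := h1.left_mem
  have hy := h2.right_mem
  rw [Set.disjoint_left] at hd
  refine (h1.symm.assign_right.union h2.assign_right ?_).mono le_rfl ?_
  · rw [Set.disjoint_left]
    exact fun v hv hv' => hd hv.1 hv'.1
  · rintro v (hv | hv)
    · refine ⟨Or.inl hv.1, ?_⟩
      rintro (h | rfl)
      exacts [hv.2 h, hd hv.1 hy]
    · refine ⟨Or.inr hv.1, ?_⟩
      rintro (rfl | h)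
      exacts [hd hx hv.1, hv.2 h]

lemma IsCycleOn.assign {P : Set α} {C : Set β} (h : G.IsCycleOn P C) : Assign G C P := by
  obtain ⟨x, y, F, e, hp, he, hF, rfl⟩ := h
  refine ((Assign.singleton he.inc_right).union hp.assign_right (by simp)).mono (by simp) ?_
  rintro v (rfl | hv)
  exacts [hp.right_mem, hv.1]

lemma IsCycleOn.assign_diff {P : Set α} {C : Set β} (h : G.IsCycleOn P C) {e : β}
    (heC : e ∈ C) {z : α} (hz : z ∈ P) : Assign G (C \ {e}) (P \ {z}) := by
  obtain ⟨x, y, F, f, hp, hf, hF, rfl⟩ := h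
  by_cases hef : e = f
  · subst hef
    simpa [hF] using hp.assign hz
  · have heF := heC.resolve_left hef
    obtain ⟨u, v, P₁, F₁, P₂, F₂, h1, -, h2, hP, hd, hFe⟩ := hp.split_edge heF
    rw [Set.disjoint_left] at hd
    have hy := h2.right_mem
    have := h2.trans (.cons hf.symm h1 fun h => hd h hy) (by
      rintro w ⟨hw, rfl | hw'⟩
      exacts [rfl, absurd hw (hd hw')])
    refine (this.assign (z := z) ?_).mono ?_ ?_
    · rcases hP ▸ hz with h | h
      exacts [Or.inr (Or.inr h), Or.inl h]
    · rintro g ⟨rfl | hg, hge⟩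
      · exact Or.inr (Or.inl rfl)
      · have : g ∈ F₁ ∪ F₂ := hFe ▸ ⟨hg, hge⟩
        rcases this with h | h
        exacts [Or.inr (Or.inr h), Or.inl h]
    · rintro w ⟨h | rfl | h, hw⟩
      exacts [⟨hP ▸ Or.inr h, hw⟩, ⟨hp.right_mem, hw⟩, ⟨hP ▸ Or.inl h, hw⟩]

lemma endSet_eq_of_isCycleOn {P : Set α} {C : Set β} (h : G.IsCycleOn P C) :
    G.endSet C ⊆ P := fun _ ⟨_, he, hv⟩ => h.inc_mem he hv

/-- No cycle contains another one. -/
lemma IsCycleEdgeSet.eq_of_subset {C D : Set β} (hC : G.IsCycleEdgeSet C)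
    (hD : G.IsCycleEdgeSet D) (h : D ⊆ C) : D = C := by
  by_contra hne
  obtain ⟨e, heC, heD⟩ := exists_of_ssubset (h.ssubset_of_ne hne)
  obtain ⟨P, hC⟩ := hC
  obtain ⟨Q, hD⟩ := hD
  obtain ⟨f, hf⟩ := hD.nonempty
  obtain ⟨a, b, hab⟩ := exists_isLink_of_mem_edgeSet (hD.subset_edgeSet hf)
  have haD : a ∈ G.endSet D := ⟨f, hf, hab.inc_left⟩
  have h1 := (hC.assign_diff heC (hC.inc_mem (h hf) hab.inc_left)).mono
    (subset_sdiff_singleton h heD) le_rfl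
  have h2 := h1.ncard_le hD.finite.2
  have h3 : (G.endSet D ∩ (P \ {a})).ncard < (G.endSet D).ncard :=
    ncard_lt_ncard ⟨inter_subset_left, fun h => (h haD).2.2 rfl⟩ (finite_endSet hD.finite.2)
  have h4 := ncard_le_ncard (endSet_eq_of_isCycleOn hD) hD.finite.1
  have h5 := hD.ncard
  omega

lemma theta_assign {x y : α} {P₁ P₂ P₃ : Set α} {F₁ F₂ F₃ : Set β} {e : β}
    (h1 : G.IsPathBetween x y P₁ F₁) (h2 : G.IsPathBetween x y P₂ F₂)
    (h3 : G.IsPathBetween x y P₃ F₃) (h12 : P₁ ∩ P₂ = {x, y}) (h13 : P₁ ∩ P₃ = {x, y})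
    (h23 : P₂ ∩ P₃ = {x, y}) (he : e ∈ F₁) : Assign G ((F₁ ∪ F₂ ∪ F₃) \ {e}) univ := by
  refine (((h1.assign_diff he).union h2.symm.assign_right ?_).union h3.assign_right ?_).mono ?_
    (subset_univ _)
  · rw [Set.disjoint_left]
    exact fun v hv hv' => hv.2 (h12 ▸ ⟨hv.1, hv'.1⟩)
  · rw [Set.disjoint_left]
    rintro v (hv | hv) hv'
    · exact hv.2 (h13 ▸ ⟨hv.1, hv'.1⟩)
    · have : v ∈ P₂ ∩ P₃ := ⟨hv.1, hv'.1⟩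
      rw [h23] at this
      exact this.elim hv.2 hv'.2
  · rintro g ⟨(h | h) | h, hg⟩
    exacts [Or.inl (Or.inl ⟨h, hg⟩), Or.inl (Or.inr h), Or.inr h]

lemma IsBicycle.assign_diff {C : Set β} (h : G.IsBicycle C) {e : β} (he : e ∈ C) :
    Assign G (C \ {e}) univ := by
  obtain h | h | h := h
  · obtain ⟨x, y, P₁, P₂, P₃, F₁, F₂, F₃, hxy, h1, h2, h3, h12, h13, h23, d12, d13, d23, rfl⟩ := h
    rcases he with (he | he) | he
    · exact theta_assign h1 h2 h3 h12 h13 h23 he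
    · refine (theta_assign h2 h1 h3 (by rw [inter_comm, h12]) h23 h13 he).mono ?_ le_rfl
      rw [union_comm F₂]
    · refine (theta_assign h3 h1 h2 (by rw [inter_comm, h13]) (by rw [inter_comm, h23]) h12
        he).mono ?_ le_rfl
      rw [union_comm _ F₃, union_assoc]
  · obtain ⟨x, P₁, P₂, F₁, F₂, h1, h2, hP, hd, rfl⟩ := h
    have hx : x ∈ P₁ ∩ P₂ := hP ▸ rfl
    rcases he with he | he
    · refine ((h1.assign_diff he hx.1).union h2.assign ?_).mono ?_ (subset_univ _)
      · rw [Set.disjoint_left]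
        intro v hv hv'
        have : v ∈ P₁ ∩ P₂ := ⟨hv.1, hv'⟩
        rw [hP] at this
        exact hv.2 this
      · rintro g ⟨h | h, hg⟩
        exacts [Or.inl ⟨h, hg⟩, Or.inr h]
    · refine (h1.assign.union (h2.assign_diff he hx.2) ?_).mono ?_ (subset_univ _)
      · rw [Set.disjoint_left]
        intro v hv hv'
        have : v ∈ P₁ ∩ P₂ := ⟨hv, hv'.1⟩
        rw [hP] at this
        exact hv'.2 this
      · rintro g ⟨h | h, hg⟩
        exacts [Or.inl h, Or.inr ⟨h, hg⟩]
  · obtain ⟨x, y, P₁, P₂, P, F₁, F₂, F, h1, h2, hP, h, hx, hy, rfl⟩ := h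
    have hx1 : ∀ {v}, v ∈ P → v ∈ P₁ → v = x := fun hv hv' => by
      have : _ ∈ P ∩ P₁ := ⟨hv, hv'⟩
      rwa [hx] at this
    have hy2 : ∀ {v}, v ∈ P → v ∈ P₂ → v = y := fun hv hv' => by
      have : _ ∈ P ∩ P₂ := ⟨hv, hv'⟩
      rwa [hy] at this
    have hxm : x ∈ P ∩ P₁ := hx ▸ rfl
    have hym : y ∈ P ∩ P₂ := hy ▸ rfl
    rw [Set.disjoint_left] at hP
    rcases he with (he | he) | he
    · refine (((h1.assign_diff he hxm.2).union h2.assign ?_).union h.assign_right ?_).mono ?_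
        (subset_univ _)
      · rw [Set.disjoint_left]
        exact fun v hv hv' => hP hv.1 hv'
      · rw [Set.disjoint_left]
        rintro v (hv | hv) hv'
        exacts [hv.2 (hx1 hv'.1 hv.1), hv'.2 (hy2 hv'.1 hv)]
      · rintro g ⟨(h | h) | h, hg⟩
        exacts [Or.inl (Or.inl ⟨h, hg⟩), Or.inl (Or.inr h), Or.inr h]
    · refine ((h1.assign.union (h2.assign_diff he hym.2) ?_).union h.symm.assign_right ?_).mono ?_
        (subset_univ _)
      · rw [Set.disjoint_left]
        exact fun v hv hv' => hP hv hv'.1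
      · rw [Set.disjoint_left]
        rintro v (hv | hv) hv'
        exacts [hv'.2 (hx1 hv'.1 hv), hv.2 (hy2 hv'.1 hv.1)]
      · rintro g ⟨(h | h) | h, hg⟩
        exacts [Or.inl (Or.inl h), Or.inl (Or.inr ⟨h, hg⟩), Or.inr h]
    · refine ((h1.assign.union h2.assign ?_).union (h.assign_diff he) ?_).mono ?_
        (subset_univ _)
      · rw [Set.disjoint_left]
        exact fun v hv hv' => hP hv hv'
      · rw [Set.disjoint_left]
        rintro v (hv | hv) hv'
        exacts [hv'.2 (Or.inl (hx1 hv'.1 hv)), hv'.2 (Or.inr (hy2 hv'.1 hv))]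
      · rintro g ⟨(h | h) | h, hg⟩
        exacts [Or.inl (Or.inl h), Or.inl (Or.inr h), Or.inr ⟨h, hg⟩]

/-- No bicycle contains another one. -/
lemma IsBicycle.eq_of_subset {C D : Set β} (hC : G.IsBicycle C) (hD : G.IsBicycle D)
    (h : D ⊆ C) : D = C := by
  by_contra hne
  obtain ⟨e, heC, heD⟩ := exists_of_ssubset (h.ssubset_of_ne hne)
  have h1 := ((hC.assign_diff heC).mono (subset_sdiff_singleton h heD) le_rfl).ncard_le hD.spec.1
  rw [inter_univ] at h1
  have := hD.spec.2.2
  omega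

/-! ### The two matroids -/

lemma isCircuit_iff_of_antichain {M : Matroid β} {Circ : Set β → Prop}
    (hind : ∀ I, M.Indep I ↔ I ⊆ M.E ∧ ∀ C ⊆ I, ¬ Circ C) (hE : ∀ C, Circ C → C ⊆ M.E)
    (hanti : ∀ C D, Circ C → Circ D → D ⊆ C → D = C) {C : Set β} : M.IsCircuit C ↔ Circ C := by
  rw [Matroid.isCircuit_iff_forall_ssubset, Matroid.dep_iff]
  constructor
  · rintro ⟨⟨h, hCE⟩, hmin⟩
    rw [hind] at h
    push Not at h
    obtain ⟨D, hDC, hD⟩ := h hCE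
    by_contra hC
    have hne : D ≠ C := fun h => hC (h ▸ hD)
    exact ((hind D).1 (hmin (hDC.ssubset_of_ne hne))).2 D le_rfl hD
  · intro hC
    refine ⟨⟨fun h => ((hind C).1 h).2 C le_rfl hC, hE C hC⟩, fun I hI => (hind I).2
      ⟨hI.subset.trans (hE C hC), fun D hDI hD => ?_⟩⟩
    have := hanti C D hC hD (hDI.trans hI.subset)
    exact hI.not_subset (this ▸ hDI)

lemma bicycle_free_iff {I : Finset β} (hI : (I : Set β) ⊆ G.edgeSet) :
    (∀ C ⊆ (I : Set β), ¬ G.IsBicycle C) ↔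
      ∀ K ⊆ (I : Set β), K.ncard ≤ (G.endSet K).ncard := by
  constructor
  · intro h K hK
    by_contra! hlt
    obtain ⟨C, hC, hC'⟩ := exists_isBicycle_subset (I.finite_toSet.subset hK) (hK.trans hI) hlt
    exact h C (hC.trans hK) hC'
  · intro h C hC hC'
    exact absurd (h C hC) (not_le.2 hC'.spec.2.2)

lemma bicircular_aug {I J : Finset β} (hIE : (I : Set β) ⊆ G.edgeSet)
    (hJE : (J : Set β) ⊆ G.edgeSet) (hI : ∀ C ⊆ (I : Set β), ¬ G.IsBicycle C)
    (hJ : ∀ C ⊆ (J : Set β), ¬ G.IsBicycle C) (hIJ : I.card < J.card) :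
    ∃ e ∈ J, e ∉ I ∧ ∀ C ⊆ insert e (I : Set β), ¬ G.IsBicycle C := by
  classical
  by_contra! hcon
  have hI' := (bicycle_free_iff hIE).1 hI
  have hJ' := (bicycle_free_iff hJE).1 hJ
  -- a largest tight set spans all edges outside `I`
  have tight : ∀ S : Finset β, S ⊆ J \ I → ∃ T : Finset β, T ⊆ I ∧
      (G.endSet (T : Set β)).ncard ≤ T.card ∧ G.endSet (S : Set β) ⊆ G.endSet (T : Set β) := by
    intro S
    induction S using Finset.induction_on with
    | empty => exact fun _ => ⟨∅, by simp, by simp [endSet], by simp [endSet]⟩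
    | insert e S heS ih =>
      intro hS
      obtain ⟨T, hTI, hT, hST⟩ := ih fun f hf => hS (Finset.mem_insert_of_mem hf)
      have he := Finset.mem_sdiff.1 (hS (Finset.mem_insert_self e S))
      obtain ⟨C, hC, hC'⟩ := hcon e he.1 he.2
      obtain ⟨hCf, -, hlt⟩ := hC'.spec
      have heC : e ∈ C := by
        by_contra heC
        refine hI C (fun f hf => ?_) hC'
        have := hC hf
        exact this.resolve_left fun h => heC (h ▸ hf)
      let U : Finset β := hCf.toFinset.erase e
      have hUC : (U : Set β) = C \ {e} := by simp [U]
      have hUI : U ⊆ I := by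
        intro f hf
        have hf' : f ∈ C \ {e} := hUC ▸ hf
        have := hC hf'.1
        exact this.resolve_left hf'.2
      have hUcard : U.card + 1 = C.ncard := by
        rw [← ncard_coe_finset, hUC, ncard_sdiff_singleton_add_one heC hCf]
      have hUE : G.endSet C ⊆ G.endSet (U : Set β) := by
        have h1 := hI' U (by exact_mod_cast hUI)
        rw [ncard_coe_finset] at h1
        exact (eq_of_subset_of_ncard_le (endSet_mono (hUC ▸ sdiff_subset)) (by omega)
          (finite_endSet hCf)).symm.subset
      have hUt : (G.endSet (U : Set β)).ncard ≤ U.card := by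
        have := ncard_le_ncard (endSet_mono (G := G) (hUC ▸ sdiff_subset : (U : Set β) ⊆ C))
          (finite_endSet hCf)
        omega
      refine ⟨T ∪ U, Finset.union_subset hTI hUI, ?_, ?_⟩
      · have h1 := hI' (T ∩ U : Finset β) (by
          exact_mod_cast Finset.inter_subset_left.trans hTI)
        rw [ncard_coe_finset] at h1
        have h2 : (G.endSet ((T ∩ U : Finset β) : Set β)).ncard ≤
            (G.endSet (T : Set β) ∩ G.endSet (U : Set β)).ncard :=
          ncard_le_ncard (subset_inter (endSet_mono (by simp)) (endSet_mono (by simp)))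
            ((finite_endSet T.finite_toSet).subset inter_subset_left)
        have h3 := ncard_union_add_ncard_inter (G.endSet (T : Set β)) (G.endSet (U : Set β))
          (finite_endSet T.finite_toSet) (finite_endSet U.finite_toSet)
        have h4 := Finset.card_union_add_card_inter T U
        rw [Finset.coe_union, endSet_union]
        omega
      · rw [Finset.coe_union, endSet_union, Finset.coe_insert, insert_eq, endSet_union]
        refine union_subset ((endSet_mono (by simpa)).trans (hUE.trans subset_union_right))
          (hST.trans subset_union_left)
  obtain ⟨T, hTI, hT, hsub⟩ := tight (J \ I) le_rfl
  have h1 := hJ' ((J \ I) ∪ (J ∩ T) : Finset β) (by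
    exact_mod_cast Finset.union_subset Finset.sdiff_subset Finset.inter_subset_left)
  have h2 : (G.endSet (((J \ I) ∪ (J ∩ T) : Finset β) : Set β)).ncard ≤
      (G.endSet (T : Set β)).ncard := by
    refine ncard_le_ncard ?_ (finite_endSet T.finite_toSet)
    rw [Finset.coe_union, endSet_union]
    exact union_subset hsub (endSet_mono (by simp))
  rw [ncard_coe_finset, Finset.card_union_of_disjoint] at h1
  · have h3 := Finset.card_sdiff_add_card_inter J I
    have h4 := Finset.card_sdiff_add_card_inter T J
    have h5 := Finset.card_sdiff_add_card_inter I J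
    have h6 : (T \ J).card ≤ (I \ J).card := Finset.card_le_card (Finset.sdiff_subset_sdiff hTI le_rfl)
    rw [Finset.inter_comm T J] at h4
    rw [Finset.inter_comm I J] at h5
    omega
  · rw [Finset.disjoint_left]
    intro e he he'
    exact (Finset.mem_sdiff.1 he).2 (hTI (Finset.mem_inter.1 he').2)

/-- The indicator vector modulo 2 of the ends of an edge. -/
noncomputable def edgeVec (G : Graph α β) (e : β) : α → ZMod 2 :=
  open Classical in fun x => if G.IsNonloopAt e x then 1 else 0

lemma edgeVec_eq [DecidableEq α] {e : β} {x y : α} (h : G.IsLink e x y) :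
    edgeVec G e = Pi.single x 1 + Pi.single y 1 := by
  ext v
  simp only [edgeVec, Pi.add_apply, Pi.single_apply]
  by_cases hxy : x = y
  · subst hxy
    have hloop : ¬ G.IsNonloopAt e v := IsLoopAt.not_isNonloopAt (x := x) h v
    rw [if_neg hloop]
    split_ifs
    · rfl
    · rfl
  · by_cases hvx : v = x
    · subst hvx
      rw [if_pos ⟨y, Ne.symm hxy, h⟩]
      simp [hxy]
    · by_cases hvy : v = y
      · subst hvy
        rw [if_pos ⟨x, hxy, h.symm⟩]
        simp [hvx]
      · rw [if_neg]
        · simp [hvx, hvy]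
        · intro h'
          exact (h'.inc.eq_or_eq_of_isLink h).elim hvx hvy

lemma IsPathBetween.mem_span [DecidableEq α] {x y : α} {P : Set α} {F : Set β}
    (h : G.IsPathBetween x y P F) :
    (Pi.single x 1 + Pi.single y 1 : α → ZMod 2) ∈ Submodule.span (ZMod 2) (edgeVec G '' F) := by
  induction h with
  | @nil x _ =>
    rw [← Pi.single_add, CharTwo.add_self_eq_zero, Pi.single_zero]
    exact Submodule.zero_mem _
  | @cons x w y e P F he hp hx ih =>
    have h1 : edgeVec G e ∈ Submodule.span (ZMod 2) (edgeVec G '' insert e F) :=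
      Submodule.subset_span ⟨e, Or.inl rfl, rfl⟩
    have h2 := Submodule.span_mono (image_mono (f := edgeVec G) (subset_insert e F)) ih
    have := Submodule.add_mem _ h1 h2
    rw [edgeVec_eq he, add_assoc, ← add_assoc (Pi.single w 1), ← Pi.single_add,
      CharTwo.add_self_eq_zero, Pi.single_zero, zero_add] at this
    exact this

lemma cycle_free_iff {I : Finset β} (hI : (I : Set β) ⊆ G.edgeSet) :
    (∀ C ⊆ (I : Set β), ¬ G.IsCycleEdgeSet C) ↔
      LinearIndepOn (ZMod 2) (edgeVec G) (I : Set β) := by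
  classical
  constructor
  · intro h
    rw [linearIndepOn_finset_iff]
    intro g hg
    by_contra! hne
    obtain ⟨e₀, he₀, hge₀⟩ := hne
    let K : Finset β := I.filter fun e => g e ≠ 0
    have hKI : (K : Set β) ⊆ I := by exact_mod_cast Finset.filter_subset _ I
    have hg1 : ∀ e ∈ K, g e = 1 := by
      intro e he
      have : ∀ t : ZMod 2, t ≠ 0 → t = 1 := by decide
      exact this _ (Finset.mem_filter.1 he).2
    have hsum : ∑ e ∈ K, edgeVec G e = 0 := by
      rw [← hg, Finset.sum_filter]
      refine Finset.sum_congr rfl fun e he => ?_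
      split_ifs with h
      · rw [hg1 e (Finset.mem_filter.2 ⟨he, h⟩), one_smul]
      · push Not at h
        rw [h, zero_smul]
    have hloop : ∀ e ∈ K, ∀ x, ¬ G.IsLoopAt e x := by
      intro e he x hx
      exact h {e} (singleton_subset_iff.2 (hKI he))
        ⟨{x}, x, x, ∅, e, .nil hx.vertex_mem, hx, by simp, by simp⟩
    obtain ⟨P, F, hc, hF⟩ := exists_isCycleOn_subset (G := G) K.finite_toSet
      ⟨e₀, Finset.mem_coe.2 (Finset.mem_filter.2 ⟨he₀, hge₀⟩)⟩ (hKI.trans hI) (by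
        intro e he x hex
        by_contra! hall
        have hx := congrFun hsum x
        rw [Finset.sum_apply, Finset.sum_eq_single e] at hx
        · have : G.IsNonloopAt e x :=
            hex.isLoopAt_or_isNonloopAt.resolve_left (hloop e he x)
          simp [edgeVec, this] at hx
        · intro f hf hfe
          have : ¬ G.IsNonloopAt f x := fun h => hall f hf hfe h.inc
          simp [edgeVec, this]
        · exact fun h => absurd he h)
    exact h F (hF.trans hKI) ⟨P, hc⟩
  · rintro h C hC ⟨P, x, y, F, e, hp, he, heF, rfl⟩
    refine (h.mono hC).notMem_span_of_insert heF ?_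
    rw [edgeVec_eq he]
    exact hp.mem_span

lemma cycle_aug {I J : Finset β} (hIE : (I : Set β) ⊆ G.edgeSet)
    (hJE : (J : Set β) ⊆ G.edgeSet) (hI : ∀ C ⊆ (I : Set β), ¬ G.IsCycleEdgeSet C)
    (hJ : ∀ C ⊆ (J : Set β), ¬ G.IsCycleEdgeSet C) (hIJ : I.card < J.card) :
    ∃ e ∈ J, e ∉ I ∧ ∀ C ⊆ insert e (I : Set β), ¬ G.IsCycleEdgeSet C := by
  classical
  by_contra! hcon
  have hI' := (cycle_free_iff hIE).1 hI
  have hJ' := (cycle_free_iff hJE).1 hJ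
  have hsub : edgeVec G '' (J : Set β) ⊆ Submodule.span (ZMod 2) (edgeVec G '' (I : Set β)) := by
    rintro _ ⟨e, he, rfl⟩
    by_cases heI : e ∈ I
    · exact Submodule.subset_span ⟨e, heI, rfl⟩
    · by_contra hspan
      obtain ⟨C, hC, hC'⟩ := hcon e he heI
      have hE : ((insert e I : Finset β) : Set β) ⊆ G.edgeSet := by
        rw [Finset.coe_insert]
        exact insert_subset (hJE he) hIE
      refine (cycle_free_iff hE).2 ?_ C (by simpa using hC) hC'
      rw [Finset.coe_insert]
      exact (linearIndepOn_insert (by simpa)).2 ⟨hI', hspan⟩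
  have hcard : ∀ K : Finset β, LinearIndepOn (ZMod 2) (edgeVec G) (K : Set β) →
      Module.finrank (ZMod 2) (Submodule.span (ZMod 2) (edgeVec G '' (K : Set β))) = K.card := by
    intro K hK
    have := finrank_span_eq_card (b := fun e : (K : Set β) => edgeVec G e) hK
    rw [← image_eq_range] at this
    simpa using this
  have hfin : FiniteDimensional (ZMod 2) (Submodule.span (ZMod 2) (edgeVec G '' (I : Set β))) :=
    FiniteDimensional.span_of_finite _ (I.finite_toSet.image _)
  have := Submodule.finrank_mono (Submodule.span_le.2 hsub)
  rw [hcard I hI', hcard J hJ'] at this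
  omega

/-- The cycle matroid of `G`: the matroid on the edge set of `G` in which a set is independent if it
contains no cycle of `G`. Its circuits are the cycles of `G`, see
`Graph.isCircuit_cycleMatroid_iff`. -/
noncomputable def cycleMatroid (G : Graph α β) : Matroid β :=
  (@IndepMatroid.ofFinset β (Classical.decEq β) G.edgeSet
    (fun I => (I : Set β) ⊆ G.edgeSet ∧ ∀ C ⊆ (I : Set β), ¬ G.IsCycleEdgeSet C)
    (by
      refine ⟨by simp, ?_⟩
      rintro C hC ⟨P, h⟩
      exact h.nonempty.ne_empty (by simpa using hC))
    (fun I J hJ hIJ => ⟨(Finset.coe_subset.2 hIJ).trans hJ.1,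
      fun C hC => hJ.2 C (hC.trans (Finset.coe_subset.2 hIJ))⟩)
    (fun I J hI hJ h => by
      obtain ⟨e, he, heI, h⟩ := cycle_aug hI.1 hJ.1 hI.2 hJ.2 h
      refine ⟨e, he, heI, ?_⟩
      rw [@Finset.coe_insert β (Classical.decEq β)]
      exact ⟨insert_subset (hJ.1 he) hI.1, h⟩)
    (fun _ hI => hI.1)).matroid

/-- The bicircular matroid of `G`: the matroid on the edge set of `G` in which a set is independent
if it contains no bicycle of `G`. Its circuits are the bicycles of `G`, see
`Graph.isCircuit_bicircularMatroid_iff`. -/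
noncomputable def bicircularMatroid (G : Graph α β) : Matroid β :=
  (@IndepMatroid.ofFinset β (Classical.decEq β) G.edgeSet
    (fun I => (I : Set β) ⊆ G.edgeSet ∧ ∀ C ⊆ (I : Set β), ¬ G.IsBicycle C)
    (by
      refine ⟨by simp, fun C hC h => ?_⟩
      have h1 := h.spec.2.2
      simp only [Finset.coe_empty, subset_empty_iff] at hC
      simp [hC] at h1)
    (fun I J hJ hIJ => ⟨(Finset.coe_subset.2 hIJ).trans hJ.1,
      fun C hC => hJ.2 C (hC.trans (Finset.coe_subset.2 hIJ))⟩)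
    (fun I J hI hJ h => by
      obtain ⟨e, he, heI, h⟩ := bicircular_aug hI.1 hJ.1 hI.2 hJ.2 h
      refine ⟨e, he, heI, ?_⟩
      rw [@Finset.coe_insert β (Classical.decEq β)]
      exact ⟨insert_subset (hJ.1 he) hI.1, h⟩)
    (fun _ hI => hI.1)).matroid

@[simp] lemma cycleMatroid_ground (G : Graph α β) : G.cycleMatroid.E = G.edgeSet := rfl

@[simp] lemma bicircularMatroid_ground (G : Graph α β) : G.bicircularMatroid.E = G.edgeSet := rfl

lemma cycleMatroid_indep_iff {I : Set β} :
    G.cycleMatroid.Indep I ↔ I ⊆ G.edgeSet ∧ ∀ C ⊆ I, ¬ G.IsCycleEdgeSet C := by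
  rw [cycleMatroid, IndepMatroid.matroid_indep_iff, @IndepMatroid.ofFinset_indep' β (Classical.decEq β)]
  constructor
  · refine fun h => ⟨fun e he => ?_, fun C hC hC' => ?_⟩
    · exact (h {e} (by simpa)).1 (by simp)
    · obtain ⟨P, hP⟩ := id hC'
      exact (h hP.finite.2.toFinset (by simpa)).2 C (by simp) hC'
  · exact fun h J hJ => ⟨hJ.trans h.1, fun C hC => h.2 C (hC.trans hJ)⟩

lemma bicircularMatroid_indep_iff {I : Set β} :
    G.bicircularMatroid.Indep I ↔ I ⊆ G.edgeSet ∧ ∀ C ⊆ I, ¬ G.IsBicycle C := by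
  rw [bicircularMatroid, IndepMatroid.matroid_indep_iff, @IndepMatroid.ofFinset_indep' β (Classical.decEq β)]
  constructor
  · refine fun h => ⟨fun e he => ?_, fun C hC hC' => ?_⟩
    · exact (h {e} (by simpa)).1 (by simp)
    · exact (h hC'.spec.1.toFinset (by simpa)).2 C (by simp) hC'
  · exact fun h J hJ => ⟨hJ.trans h.1, fun C hC => h.2 C (hC.trans hJ)⟩

theorem isCircuit_cycleMatroid_iff {C : Set β} :
    G.cycleMatroid.IsCircuit C ↔ G.IsCycleEdgeSet C :=
  isCircuit_iff_of_antichain (fun _ => cycleMatroid_indep_iff)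
    (fun _ ⟨_, h⟩ => h.subset_edgeSet) fun _ _ hC hD h => hC.eq_of_subset hD h

theorem isCircuit_bicircularMatroid_iff {C : Set β} :
    G.bicircularMatroid.IsCircuit C ↔ G.IsBicycle C :=
  isCircuit_iff_of_antichain (fun _ => bicircularMatroid_indep_iff)
    (fun _ h => h.spec.2.1) fun _ _ hC hD h => hC.eq_of_subset hD h

/-- `G` is 3-connected: it has more than three vertices, and it stays connected when any set of at
most two vertices is deleted. -/
def IsThreeConnected (G : Graph α β) : Prop :=
  3 < G.vertexSet.encard ∧
    ∀ X ⊆ G.vertexSet, X.encard ≤ 2 → (G.deleteVerts X).toSimpleGraph.Connected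

end Graph

namespace Matroid

variable {β : Type*}

/-- A permutation of the ground set of `M` is an automorphism of `M` if it maps circuits, and only
circuits, to circuits. -/
def IsAutomorphism (M : Matroid β) (σ : Equiv.Perm M.E) : Prop :=
  ∀ C : Set M.E, M.IsCircuit ((↑) '' (σ '' C)) ↔ M.IsCircuit ((↑) '' C)

/-- A set of elements of `M` is a fixing set if the identity is the only automorphism of `M` that
fixes each of its elements. -/
def IsFixingSet (M : Matroid β) (S : Set M.E) : Prop :=
  ∀ σ : Equiv.Perm M.E, M.IsAutomorphism σ → (∀ e ∈ S, σ e = e) → σ = 1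

/-- The fixing number of `M`: the minimum size of a fixing set. The whole ground set is a fixing
set, so this is a minimum over a nonempty family. -/
noncomputable def fixingNumber (M : Matroid β) : ℕ∞ :=
  sInf {r | ∃ S : Set M.E, M.IsFixingSet S ∧ S.encard = r}

end Matroid

/-!
# Cycle matroids and bicircular matroids of 3-connected graphs have equal fixing numbers

The two matroids of `G` have the same automorphisms, namely the permutations of the edges that map
stars of vertices to stars of vertices; this makes their fixing sets coincide.

That an automorphism preserves stars is seen from the complements of the connected flats of the
matroid (`Graph.IsConnectedFlatCompl`), a notion that only depends on the circuits.

* Such a complement `S` contains a star (`Graph.IsConnectedFlatCompl.exists_incidenceSet_subset`).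
  Otherwise every vertex has an edge outside `S`; the two ends of some `e ∈ S` then lie on a common
  circuit outside `S`, and this circuit together with `e` contains a circuit that meets `S` in `e`
  only.
* For the cycle matroid every star is such a complement, since `G - v` is 2-connected and any two of
  its edges lie on a common cycle (`Graph.IsTwoConnected.exists_isCycleOn`). For the bicircular
  matroid the same holds unless `G - v` is a cycle, since an ear added to a cycle gives a theta
  (`Graph.IsTwoConnected.exists_isTheta`).

As no star contains another one, the stars are exactly the minimal complements, except that in the
bicircular case a vertex `v` for which `G - v` is a cycle escapes. With at least five vertices there
is at most one such vertex (`Graph.IsThreeConnected.isHub_unique`), and its star consists of the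
edges that are not in two of the other stars. On four vertices this breaks down: the bicircular
matroid of `K₄` is uniform.

Conversely, a permutation of the edges that preserves stars comes with a permutation of the vertices
that respects incidence, and so preserves cycles and bicycles.
-/

namespace Graph

variable {α β : Type*} {G H : Graph α β}

/-! ### Finding paths, cycles and ears -/

lemma IsPathBetween.mono {x y : α} {P : Set α} {F : Set β} (h : H.IsPathBetween x y P F)
    (hle : H ≤ G) : G.IsPathBetween x y P F := by
  induction h with
  | nil hx => exact .nil (hle.vertexSet_mono hx)
  | cons he _ hx ih => exact .cons (he.mono hle) ih hx

lemma IsCycleOn.mono {P : Set α} {F : Set β} (h : H.IsCycleOn P F) (hle : H ≤ G) :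
    G.IsCycleOn P F := by
  obtain ⟨x, y, F', e, hp, he, heF, rfl⟩ := h
  exact ⟨x, y, F', e, hp.mono hle, he.mono hle, heF, rfl⟩

lemma IsTheta.mono {C : Set β} (h : H.IsTheta C) (hle : H ≤ G) : G.IsTheta C := by
  obtain ⟨x, y, P₁, P₂, P₃, F₁, F₂, F₃, hxy, h1, h2, h3, h⟩ := h
  exact ⟨x, y, P₁, P₂, P₃, F₁, F₂, F₃, hxy, h1.mono hle, h2.mono hle, h3.mono hle, h⟩

lemma exists_isPathBetween_of_connected (hG : G.toSimpleGraph.Connected) {x y : α}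
    (hx : x ∈ G.vertexSet) (hy : y ∈ G.vertexSet) : ∃ P F, G.IsPathBetween x y P F := by
  have key : ∀ {a b : G.vertexSet}, G.toSimpleGraph.Walk a b →
      ∃ P F, G.IsPathBetween a b P F := by
    intro a b w
    induction w with
    | nil => exact ⟨_, _, .nil (Subtype.prop _)⟩
    | @cons a c b hac _ ih =>
      obtain ⟨P, F, hp⟩ := ih
      by_cases ha : (a : α) ∈ P
      · obtain ⟨-, -, P₂, F₂, -, h2, -⟩ := hp.split ha
        exact ⟨P₂, F₂, h2⟩
      · obtain ⟨-, e, he⟩ := (toSimpleGraph_adj ..).mp hac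
        exact ⟨_, _, .cons he hp ha⟩
  obtain ⟨w⟩ := hG.preconnected ⟨x, hx⟩ ⟨y, hy⟩
  exact key w

/-- A path that ends in `W` has an initial segment that meets `W` only in its last vertex. -/
lemma IsPathBetween.exists_first_mem {x y : α} {P W : Set α} {F : Set β}
    (h : G.IsPathBetween x y P F) (hy : y ∈ W) :
    ∃ y' P' F', G.IsPathBetween x y' P' F' ∧ P' ⊆ P ∧ P' ∩ W = {y'} := by
  induction h with
  | @nil x hx => exact ⟨x, _, _, .nil hx, le_rfl, by simpa using hy⟩
  | @cons x w y e P F he hp hx ih =>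
    by_cases hxW : x ∈ W
    · exact ⟨x, _, _, .nil he.left_mem, by simp, by simpa using hxW⟩
    · obtain ⟨y', P', F', h, hP, hW⟩ := ih hy
      exact ⟨y', _, _, .cons he h fun hx' => hx (hP hx'), insert_subset_insert hP,
        by rw [insert_inter_of_notMem hxW, hW]⟩

lemma IsPathBetween.exists_isLink_mem_notMem {x y : α} {P W : Set α} {F : Set β}
    (h : G.IsPathBetween x y P F) (hx : x ∉ W) (hy : y ∈ W) :
    ∃ e z w, G.IsLink e z w ∧ z ∈ W ∧ w ∉ W := by
  induction h with
  | nil => exact absurd hy hx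
  | @cons x w y e P F he hp _ ih =>
    by_cases hw : w ∈ W
    · exact ⟨e, w, x, he.symm, hw, hx⟩
    · exact ih hw hy

lemma IsPathBetween.exists_head {x y : α} {P : Set α} {F : Set β} (h : G.IsPathBetween x y P F)
    (hxy : x ≠ y) : ∃ e ∈ F, ∃ w ∈ P, G.IsLink e x w ∧ w ≠ x := by
  cases h with
  | nil => exact absurd rfl hxy
  | @cons _ w _ e P F he hp hx =>
    exact ⟨e, Or.inl rfl, w, Or.inr hp.left_mem, he, fun h => hx (h ▸ hp.left_mem)⟩

lemma IsPathBetween.isCycleOn_union {x y : α} {P Q : Set α} {F D : Set β}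
    (h : G.IsPathBetween x y P F) (h' : G.IsPathBetween x y Q D) (hxy : x ≠ y)
    (hPQ : P ∩ Q = {x, y}) (hFD : Disjoint F D) : G.IsCycleOn (P ∪ Q) (F ∪ D) := by
  cases h' with
  | nil => exact absurd rfl hxy
  | @cons _ w _ e Q D he hp hx =>
    rw [disjoint_insert_right] at hFD
    have hI : P ∩ Q ⊆ {y} := by
      intro v hv
      have : v ∈ P ∩ insert x Q := ⟨hv.1, Or.inr hv.2⟩
      rw [hPQ] at this
      exact this.resolve_left fun h => hx (h ▸ hv.2)
    have := h.trans hp.symm hI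
    rw [union_insert, insert_eq_of_mem (show x ∈ P ∪ Q from Or.inl h.left_mem)]
    refine ⟨x, w, _, e, this, he, ?_, union_insert⟩
    rintro (h1 | h1)
    exacts [hFD.1 h1, hx (hp.inc_mem h1 he.inc_left)]

/-- `G` has at least three vertices, and any two vertices are joined by a path that avoids a given
third one. -/
structure IsTwoConnected (G : Graph α β) : Prop where
  exists_ne : ∀ x y, ∃ z ∈ G.vertexSet, z ≠ x ∧ z ≠ y
  exists_path : ∀ x ∈ G.vertexSet, ∀ y ∈ G.vertexSet, ∀ z, z ≠ x → z ≠ y →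
    ∃ P F, G.IsPathBetween x y P F ∧ z ∉ P

lemma IsTwoConnected.exists_isPathBetween (hG : G.IsTwoConnected) {x y : α}
    (hx : x ∈ G.vertexSet) (hy : y ∈ G.vertexSet) : ∃ P F, G.IsPathBetween x y P F := by
  obtain ⟨z, -, hzx, hzy⟩ := hG.exists_ne x y
  obtain ⟨P, F, h, -⟩ := hG.exists_path x hx y hy z hzx hzy
  exact ⟨P, F, h⟩

/-- In a 2-connected graph, an edge that leaves a set `W` of at least two vertices starts an ear
of `W`. Here `K` stands for a set of edges with all their ends in `W`, from which the ear is
required to be disjoint. -/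
lemma IsTwoConnected.exists_ear (hG : G.IsTwoConnected) {W : Set α} {K : Set β} {f : β}
    {y z w : α} (hK : ∀ e ∈ K, ∀ x, G.Inc e x → x ∈ W) (hfK : f ∉ K) (hf : G.IsLink f z w)
    (hwz : w ≠ z) (hz : z ∈ W) (hy : y ∈ W) (hyV : y ∈ G.vertexSet) (hyz : y ≠ z) :
    ∃ y' ∈ W, y' ≠ z ∧ ∃ Q D, G.IsPathBetween z y' Q D ∧ Q ∩ W = {z, y'} ∧ f ∈ D ∧
      Disjoint D K := by
  obtain ⟨y', P, F, hp, hzP, hPW⟩ : ∃ y' P F, G.IsPathBetween w y' P F ∧ z ∉ P ∧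
      P ∩ W = {y'} := by
    obtain ⟨P, F, hp, hzP⟩ := hG.exists_path w hf.right_mem y hyV z hwz.symm hyz.symm
    obtain ⟨y', P', F', hp', hP', hW⟩ := hp.exists_first_mem hy
    exact ⟨y', P', F', hp', fun h => hzP (hP' h), hW⟩
  have hy' : y' ∈ P ∩ W := hPW ▸ rfl
  have hpath := IsPathBetween.cons hf hp hzP
  refine ⟨y', hy'.2, fun h => hzP (h ▸ hy'.1), _, _, hpath, ?_, Or.inl rfl, ?_⟩
  · rw [insert_inter_of_mem hz, hPW]
  · rw [Set.disjoint_left]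
    intro e heD heK
    have heq : ∀ v, G.Inc e v → v ∈ ({z, y'} : Set α) := by
      intro v hv
      rw [← hPW, ← insert_inter_of_mem hz]
      exact ⟨hpath.inc_mem heD hv, hK e heK v hv⟩
    obtain ⟨a, b, hab, -, -, hne⟩ := hpath.ends e heD
    have hez : G.Inc e z := by
      rcases heq a hab.inc_left with rfl | rfl
      · exact hab.inc_left
      · rcases heq b hab.inc_right with rfl | rfl
        exacts [hab.inc_right, absurd rfl hne]
    have := hpath.head_unique heD (Or.inl rfl) hez hf.inc_left
    exact hfK (this ▸ heK)

lemma IsCycleOn.exists_ne_mem [G.Loopless] {P : Set α} {C : Set β} (h : G.IsCycleOn P C) (z : α) :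
    ∃ y ∈ P, y ≠ z := by
  obtain ⟨e, he⟩ := h.nonempty
  obtain ⟨a, b, hab⟩ := exists_isLink_of_mem_edgeSet (h.subset_edgeSet he)
  by_cases haz : a = z
  · exact ⟨b, h.inc_mem he hab.inc_right, fun hb => hab.ne (haz.trans hb.symm)⟩
  · exact ⟨a, h.inc_mem he hab.inc_left, haz⟩

lemma IsTwoConnected.exists_ear_of_isCycleOn [G.Loopless] (hG : G.IsTwoConnected) {P : Set α}
    {C : Set β} (hC : G.IsCycleOn P C) {f : β} {z : α} (hz : z ∈ P) (hf : G.Inc f z)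
    (hfC : f ∉ C) :
    ∃ y ∈ P, y ≠ z ∧ ∃ Q D, G.IsPathBetween z y Q D ∧ Q ∩ P = {z, y} ∧ f ∈ D ∧ Disjoint D C := by
  obtain ⟨y, hy, hyz⟩ := hC.exists_ne_mem z
  obtain ⟨w, hw⟩ := hf
  exact hG.exists_ear (fun e he x hx => hC.inc_mem he hx) hfC hw hw.ne.symm hz hy
    (hC.subset_vertexSet hy) hyz

/-- If a cycle contains `e` and an end of `f`, it can be rerouted through `f`. -/
lemma IsTwoConnected.exists_isCycleOn_of_inc [G.Loopless] (hG : G.IsTwoConnected) {P : Set α}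
    {C : Set β} (hC : G.IsCycleOn P C) {e f : β} {z : α} (he : e ∈ C) (hz : z ∈ P)
    (hf : G.Inc f z) : ∃ P' C', G.IsCycleOn P' C' ∧ e ∈ C' ∧ f ∈ C' := by
  by_cases hfC : f ∈ C
  · exact ⟨P, C, hC, he, hfC⟩
  obtain ⟨y, hy, hyz, Q, D, hQ, hQP, hfD, hDC⟩ := hG.exists_ear_of_isCycleOn hC hz hf hfC
  obtain ⟨P₁, F₁, P₂, F₂, h1, h2, h12, rfl, hd, rfl⟩ := hC.split hz hy hyz.symm
  rw [disjoint_union_right] at hDC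
  have aux : ∀ {P' F'}, G.IsPathBetween z y P' F' → P' ⊆ P₁ ∪ P₂ → Disjoint D F' → e ∈ F' →
      ∃ P' C', G.IsCycleOn P' C' ∧ e ∈ C' ∧ f ∈ C' := by
    intro P' F' hp hP' hd he
    refine ⟨_, _, hp.isCycleOn_union hQ hyz.symm ?_ hd.symm, Or.inl he, Or.inr hfD⟩
    refine Subset.antisymm (fun v hv => hQP ▸ ⟨hv.2, hP' hv.1⟩) ?_
    rintro v (rfl | rfl)
    exacts [⟨hp.left_mem, hQ.left_mem⟩, ⟨hp.right_mem, hQ.right_mem⟩]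
  rcases he with he | he
  · exact aux h1 subset_union_left hDC.1 he
  · exact aux h2 subset_union_right hDC.2 he

/-- Any two edges of a 2-connected graph lie on a common cycle. -/
lemma IsTwoConnected.exists_isCycleOn [G.Loopless] (hG : G.IsTwoConnected) {e f : β}
    (he : e ∈ G.edgeSet) (hf : f ∈ G.edgeSet) : ∃ P C, G.IsCycleOn P C ∧ e ∈ C ∧ f ∈ C := by
  obtain ⟨a, b, hab⟩ := exists_isLink_of_mem_edgeSet he
  -- a cycle through `e`, closing up an ear of the pair of its ends
  obtain ⟨P₀, C₀, hC₀, heC₀, haP₀⟩ : ∃ P C, G.IsCycleOn P C ∧ e ∈ C ∧ a ∈ P := by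
    obtain ⟨t, ht, hta, htb⟩ := hG.exists_ne a b
    obtain ⟨P, F, hp, hbP⟩ := hG.exists_path a hab.left_mem t ht b hab.ne.symm htb.symm
    obtain ⟨g, -, c, hc, hg, hca⟩ := hp.exists_head hta.symm
    have hge : g ∉ ({e} : Set β) := by
      rintro rfl
      exact hbP (hg.right_unique hab ▸ hc)
    obtain ⟨y, hy, hya, Q, D, hQ, -, -, hd⟩ := hG.exists_ear (W := {a, b}) (K := {e}) (y := b)
      (by rintro _ rfl x hx; exact hx.eq_or_eq_of_isLink hab) hge hg hca (Or.inl rfl) (Or.inr rfl)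
      hab.right_mem hab.ne.symm
    obtain rfl := hy.resolve_left hya
    exact ⟨Q, _, ⟨a, y, D, e, hQ, hab, by simpa using hd, rfl⟩, Or.inl rfl, hQ.left_mem⟩
  obtain ⟨s, t, hst⟩ := exists_isLink_of_mem_edgeSet hf
  have key : ∀ {x y P F}, G.IsPathBetween x y P F → (∃ P C, G.IsCycleOn P C ∧ e ∈ C ∧ x ∈ P) →
      ∃ P C, G.IsCycleOn P C ∧ e ∈ C ∧ y ∈ P := by
    intro x y P F h
    induction h with
    | nil => exact id
    | cons hg _ _ ih =>
      rintro ⟨P, C, hC, heC, hxP⟩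
      obtain ⟨P', C', hC', heC', hgC'⟩ := hG.exists_isCycleOn_of_inc hC heC hxP hg.inc_left
      exact ih ⟨P', C', hC', heC', hC'.inc_mem hgC' hg.inc_right⟩
  obtain ⟨P, F, hp⟩ := hG.exists_isPathBetween hab.left_mem hst.left_mem
  obtain ⟨P, C, hC, heC, hsP⟩ := key hp ⟨P₀, C₀, hC₀, heC₀, haP₀⟩
  exact hG.exists_isCycleOn_of_inc hC heC hsP hst.inc_left

/-- Any two edges of a 2-connected graph that is not a cycle lie in a common theta: add an ear to a
cycle through both. -/
lemma IsTwoConnected.exists_isTheta [G.Loopless] (hG : G.IsTwoConnected)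
    (hcyc : ¬ G.IsCycleEdgeSet G.edgeSet) {e f : β} (he : e ∈ G.edgeSet) (hf : f ∈ G.edgeSet) :
    ∃ C, G.IsTheta C ∧ e ∈ C ∧ f ∈ C := by
  obtain ⟨P, C, hC, heC, hfC⟩ := hG.exists_isCycleOn he hf
  obtain ⟨k, hkC, z, hz, hk⟩ : ∃ k ∉ C, ∃ z ∈ P, G.Inc k z := by
    obtain ⟨g, hg, hgC⟩ := exists_of_ssubset
      (hC.subset_edgeSet.ssubset_of_ne fun h => hcyc ⟨P, h ▸ hC⟩)
    obtain ⟨s, t, hst⟩ := exists_isLink_of_mem_edgeSet hg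
    by_cases hs : s ∈ P
    · exact ⟨g, hgC, s, hs, hst.inc_left⟩
    · obtain ⟨z₀, hz₀, -⟩ := hC.exists_ne_mem s
      obtain ⟨Q, D, hQ⟩ := hG.exists_isPathBetween hst.left_mem (hC.subset_vertexSet hz₀)
      obtain ⟨k, z, w, hk, hz, hw⟩ := hQ.exists_isLink_mem_notMem hs hz₀
      exact ⟨k, fun h => hw (hC.inc_mem h hk.inc_right), z, hz, hk.inc_left⟩
  obtain ⟨y, hy, hyz, Q, D, hQ, hQP, -, hDC⟩ := hG.exists_ear_of_isCycleOn hC hz hk hkC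
  obtain ⟨P₁, F₁, P₂, F₂, h1, h2, h12, rfl, hd, rfl⟩ := hC.split hz hy hyz.symm
  rw [disjoint_union_right] at hDC
  have aux : ∀ {P' F'}, G.IsPathBetween z y P' F' → P' ⊆ P₁ ∪ P₂ → P' ∩ Q = {z, y} := by
    intro P' F' hp hP'
    refine Subset.antisymm (fun v hv => hQP ▸ ⟨hv.2, hP' hv.1⟩) ?_
    rintro v (rfl | rfl)
    exacts [⟨hp.left_mem, hQ.left_mem⟩, ⟨hp.right_mem, hQ.right_mem⟩]
  exact ⟨F₁ ∪ F₂ ∪ D, ⟨z, y, P₁, P₂, Q, F₁, F₂, D, hyz.symm, h1, h2, hQ, h12,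
    aux h1 subset_union_left, aux h2 subset_union_right, hd, hDC.1.symm, hDC.2.symm, rfl⟩,
    Or.inl heC, Or.inl hfC⟩

lemma encard_pair_le_two (a b : α) : ({a, b} : Set α).encard ≤ 2 :=
  (encard_insert_le _ _).trans (by rw [encard_singleton]; norm_num)

/-! ### Deleting a vertex of a 3-connected graph -/

lemma IsThreeConnected.exists_path (h3 : G.IsThreeConnected) {X : Set α} (hX : X.encard ≤ 2)
    {x y : α} (hx : x ∈ G.vertexSet) (hy : y ∈ G.vertexSet) (hxX : x ∉ X) (hyX : y ∉ X) :
    ∃ P F, (G.deleteVerts X).IsPathBetween x y P F := by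
  have hdel : G.deleteVerts X = G.deleteVerts (X ∩ G.vertexSet) := by
    refine Graph.ext (by simp) fun e a b => ?_
    simp only [deleteVerts_isLink, mem_inter_iff]
    constructor
    · exact fun h => ⟨h.1, fun h' => h.2.1 h'.1, fun h' => h.2.2 h'.1⟩
    · exact fun h => ⟨h.1, fun h' => h.2.1 ⟨h', h.1.left_mem⟩, fun h' => h.2.2 ⟨h', h.1.right_mem⟩⟩
  refine exists_isPathBetween_of_connected ?_ (by simp [hx, hxX]) (by simp [hy, hyX])
  rw [hdel]
  exact h3.2 _ inter_subset_right ((encard_le_encard inter_subset_left).trans hX)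

lemma IsThreeConnected.exists_ne (h3 : G.IsThreeConnected) (a b c : α) :
    ∃ t ∈ G.vertexSet, t ≠ a ∧ t ≠ b ∧ t ≠ c := by
  by_contra! hcon
  have hsub : G.vertexSet ⊆ {a, b, c} := by
    intro t ht
    by_contra h
    simp only [mem_insert_iff, mem_singleton_iff, not_or] at h
    exact h.2.2 (hcon t ht h.1 h.2.1)
  have h1 : ({a, b, c} : Set α).encard ≤ 3 :=
    (encard_insert_le _ _).trans ((add_le_add_left (encard_pair_le_two b c) 1).trans
      (by norm_num))
  exact absurd (h3.1.trans_le ((encard_le_encard hsub).trans h1)) (lt_irrefl _)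

lemma IsThreeConnected.exists_isLink_ne (h3 : G.IsThreeConnected) {z a b : α}
    (hz : z ∈ G.vertexSet) (hza : z ≠ a) (hzb : z ≠ b) :
    ∃ e w, G.IsLink e z w ∧ w ≠ a ∧ w ≠ b := by
  obtain ⟨t, ht, hta, htb, htz⟩ := h3.exists_ne a b z
  obtain ⟨P, F, hp⟩ := h3.exists_path (X := {a, b}) (encard_pair_le_two a b) hz ht
    (by simp [hza, hzb]) (by simp [hta, htb])
  obtain ⟨e, -, w, -, he, -⟩ := hp.exists_head htz.symm
  simp only [deleteVerts_isLink, mem_insert_iff, mem_singleton_iff, not_or] at he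
  exact ⟨e, w, he.1, he.2.2⟩

lemma IsThreeConnected.isTwoConnected_deleteVerts (h3 : G.IsThreeConnected) (v : α) :
    (G.deleteVerts {v}).IsTwoConnected where
  exists_ne x y := by
    obtain ⟨t, ht, htv, htx, hty⟩ := h3.exists_ne v x y
    exact ⟨t, by simp [ht, htv], htx, hty⟩
  exists_path x hx y hy z hzx hzy := by
    simp only [vertexSet_deleteVerts, mem_sdiff, mem_singleton_iff] at hx hy
    obtain ⟨P, F, hp⟩ := h3.exists_path (X := {v, z}) (encard_pair_le_two v z) hx.1 hy.1
      (by simp [hx.2, hzx.symm]) (by simp [hy.2, hzy.symm])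
    have hle : G.deleteVerts {v, z} ≤ G.deleteVerts {v} := by
      refine ⟨?_, ?_⟩
      · simp only [vertexSet_deleteVerts]
        exact sdiff_subset_sdiff_right (by simp)
      · intro e a b h
        simp only [deleteVerts_isLink, mem_insert_iff, mem_singleton_iff, not_or] at h ⊢
        exact ⟨h.1, h.2.1.1, h.2.2.1⟩
    refine ⟨P, F, hp.mono hle, fun hzP => ?_⟩
    have := hp.subset_vertexSet hzP
    simp at this

lemma mem_edgeSet_deleteVerts_singleton {e : β} {v : α} :
    e ∈ (G.deleteVerts {v}).edgeSet ↔ e ∈ G.edgeSet \ G.incidenceSet v := by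
  simp only [edgeSet_deleteVerts, mem_ofPred_eq, mem_singleton_iff, mem_sdiff, mem_incidenceSet]
  constructor
  · rintro ⟨x, y, h, hx, hy⟩
    exact ⟨h.edge_mem, fun h' => (h'.eq_or_eq_of_isLink h).elim (fun h => hx h.symm)
      fun h => hy h.symm⟩
  · rintro ⟨he, hv⟩
    obtain ⟨x, y, h⟩ := exists_isLink_of_mem_edgeSet he
    exact ⟨x, y, h, fun hx => hv (hx ▸ h.inc_left), fun hy => hv (hy ▸ h.inc_right)⟩

/-- Distinct vertices of a 3-connected graph have incomparable stars. -/
lemma IsThreeConnected.eq_of_incidenceSet_subset (h3 : G.IsThreeConnected) {v w : α}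
    (hv : v ∈ G.vertexSet) (h : G.incidenceSet v ⊆ G.incidenceSet w) : v = w := by
  by_contra hne
  obtain ⟨e, t, he, htw, -⟩ := h3.exists_isLink_ne hv hne hne
  rcases Inc.eq_or_eq_of_isLink (h he.inc_left : G.Inc e w) he with h | h
  exacts [hne h.symm, htw h.symm]

lemma IsCycleOn.eq_or_eq_or_eq_of_inc [G.Loopless] {P : Set α} {C : Set β} (hC : G.IsCycleOn P C)
    {z : α} {e₁ e₂ e₃ : β} (h₁ : e₁ ∈ C) (h₂ : e₂ ∈ C) (h₃ : e₃ ∈ C) (hz₁ : G.Inc e₁ z)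
    (hz₂ : G.Inc e₂ z) (hz₃ : G.Inc e₃ z) : e₁ = e₂ ∨ e₁ = e₃ ∨ e₂ = e₃ := by
  obtain ⟨y, hy, hyz⟩ := hC.exists_ne_mem z
  obtain ⟨P₁, F₁, P₂, F₂, p₁, p₂, -, -, -, rfl⟩ := hC.split (hC.inc_mem h₁ hz₁) hy hyz.symm
  rcases h₁ with h₁ | h₁ <;> rcases h₂ with h₂ | h₂ <;> rcases h₃ with h₃ | h₃
  all_goals
    first
    | exact Or.inl (p₁.head_unique h₁ h₂ hz₁ hz₂)
    | exact Or.inl (p₂.head_unique h₁ h₂ hz₁ hz₂)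
    | exact Or.inr (Or.inl (p₁.head_unique h₁ h₃ hz₁ hz₃))
    | exact Or.inr (Or.inl (p₂.head_unique h₁ h₃ hz₁ hz₃))
    | exact Or.inr (Or.inr (p₁.head_unique h₂ h₃ hz₂ hz₃))
    | exact Or.inr (Or.inr (p₂.head_unique h₂ h₃ hz₂ hz₃))

/-- Deleting `v` leaves a cycle. A 3-connected graph with such a vertex is a wheel with hub `v`,
possibly with parallel spokes. -/
def IsHub (G : Graph α β) (v : α) : Prop :=
  (G.deleteVerts {v}).IsCycleEdgeSet (G.deleteVerts {v}).edgeSet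

lemma IsHub.eq_or_eq_or_eq [G.Loopless] {v z : α} (hv : G.IsHub v)
    {e₁ e₂ e₃ : β} (hz₁ : G.Inc e₁ z) (hz₂ : G.Inc e₂ z) (hz₃ : G.Inc e₃ z) (hv₁ : ¬ G.Inc e₁ v)
    (hv₂ : ¬ G.Inc e₂ v) (hv₃ : ¬ G.Inc e₃ v) : e₁ = e₂ ∨ e₁ = e₃ ∨ e₂ = e₃ := by
  obtain ⟨P, hC⟩ := hv
  have aux : ∀ {e}, G.Inc e z → ¬ G.Inc e v → e ∈ (G.deleteVerts {v}).edgeSet :=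
    fun hz hv => mem_edgeSet_deleteVerts_singleton.2 ⟨hz.edge_mem, hv⟩
  exact (hC.mono deleteVerts_le).eq_or_eq_or_eq_of_inc (aux hz₁ hv₁) (aux hz₂ hv₂) (aux hz₃ hv₃)
    hz₁ hz₂ hz₃

lemma IsThreeConnected.exists_isLink_of_isHub [G.Loopless] (h3 : G.IsThreeConnected) {w z : α}
    (hw : G.IsHub w) (hz : z ∈ G.vertexSet) (hzw : z ≠ w) : ∃ e, G.IsLink e z w := by
  obtain ⟨e₁, n₁, h₁, hn₁, -⟩ := h3.exists_isLink_ne hz hzw hzw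
  obtain ⟨e₂, n₂, h₂, hn₂, hn₂₁⟩ := h3.exists_isLink_ne hz hzw h₁.ne
  obtain ⟨e₃, n₃, h₃, hn₃₁, hn₃₂⟩ := h3.exists_isLink_ne hz h₁.ne h₂.ne
  by_cases hn₃ : n₃ = w
  · exact ⟨e₃, hn₃ ▸ h₃⟩
  have aux : ∀ {e n}, G.IsLink e z n → n ≠ w → ¬ G.Inc e w := fun h hn hw =>
    (hw.eq_or_eq_of_isLink h).elim (fun h => hzw h.symm) fun h => hn h.symm
  rcases hw.eq_or_eq_or_eq h₁.inc_left h₂.inc_left h₃.inc_left (aux h₁ hn₁) (aux h₂ hn₂)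
    (aux h₃ hn₃) with rfl | rfl | rfl
  · exact absurd (h₂.right_unique h₁) hn₂₁
  · exact absurd (h₃.right_unique h₁) hn₃₁
  · exact absurd (h₃.right_unique h₂) hn₃₂

/-- A 3-connected graph on at least five vertices has at most one hub: a second hub would be a rim
vertex of degree two after deletion of the first, but adjacent to the at least three other
vertices. -/
lemma IsThreeConnected.isHub_unique [G.Loopless] (h3 : G.IsThreeConnected)
    (h5 : 5 ≤ G.vertexSet.ncard) {u w : α} (hu : G.IsHub u) (hw : G.IsHub w) : u = w := by
  by_contra huw
  have hne : ∀ a b, ∃ t ∈ G.vertexSet, t ∉ ({u, w, a, b} : Set α) := by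
    intro a b
    refine exists_mem_notMem_of_ncard_lt_ncard (lt_of_le_of_lt ?_ h5)
    have h1 := ncard_insert_le u {w, a, b}
    have h2 := ncard_insert_le w {a, b}
    have h3 := ncard_insert_le a {b}
    have h4 := ncard_singleton b
    omega
  simp only [mem_insert_iff, mem_singleton_iff, not_or] at hne
  obtain ⟨z₁, hz₁, hu₁, hw₁, -⟩ := hne u u
  obtain ⟨z₂, hz₂, hu₂, hw₂, h21, -⟩ := hne z₁ z₁
  obtain ⟨z₃, hz₃, hu₃, hw₃, h31, h32⟩ := hne z₁ z₂
  obtain ⟨e₁, h₁⟩ := h3.exists_isLink_of_isHub hw hz₁ hw₁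
  obtain ⟨e₂, h₂⟩ := h3.exists_isLink_of_isHub hw hz₂ hw₂
  obtain ⟨e₃, h₃⟩ := h3.exists_isLink_of_isHub hw hz₃ hw₃
  have aux : ∀ {e z}, G.IsLink e z w → z ≠ u → ¬ G.Inc e u := fun h hz hu =>
    (hu.eq_or_eq_of_isLink h).elim (fun h => hz h.symm) huw
  rcases hu.eq_or_eq_or_eq h₁.inc_right h₂.inc_right h₃.inc_right (aux h₁ hu₁) (aux h₂ hu₂)
    (aux h₃ hu₃) with rfl | rfl | rfl
  · exact h21 (h₂.left_unique h₁)
  · exact h31 (h₃.left_unique h₁)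
  · exact h32 (h₃.left_unique h₂)

/-! ### Complements of connected flats -/

/-- In terms of the family `Circ` of circuits of a matroid on `E`: the set `S` is the complement of a
flat (no circuit meets `S` in a single element), neither `S` nor this flat is empty, and the flat is
connected, in the sense that any two of its elements, and each single one, lie in a circuit inside
it. -/
structure IsConnectedFlatCompl (Circ : Set β → Prop) (E S : Set β) : Prop where
  subset : S ⊆ E
  nonempty : S.Nonempty
  nonempty_sdiff : (E \ S).Nonempty
  inter_ne : ∀ C, Circ C → ∀ e, C ∩ S ≠ {e}
  exists_circ : ∀ f ∈ E \ S, ∀ g ∈ E \ S, ∃ C, Circ C ∧ C ⊆ E \ S ∧ f ∈ C ∧ g ∈ C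

lemma IsConnectedFlatCompl.image {Circ : Set β → Prop} {E S : Set β}
    (hS : IsConnectedFlatCompl Circ E S) {π : Equiv.Perm β}
    (hπ : ∀ C, Circ (π '' C) ↔ Circ C) (hE : π '' E = E) :
    IsConnectedFlatCompl Circ E (π '' S) := by
  have hdiff : E \ π '' S = π '' (E \ S) := by rw [image_sdiff π.injective, hE]
  refine ⟨hE ▸ image_mono hS.subset, hS.nonempty.image _, hdiff ▸ hS.nonempty_sdiff.image _, ?_, ?_⟩
  · intro C hC e he
    refine hS.inter_ne (π.symm '' C) ((hπ _).1 (by simpa [image_image] using hC)) (π.symm e) ?_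
    rw [← image_singleton, ← he, image_inter π.symm.injective]
    simp [image_image]
  · rw [hdiff]
    rintro _ ⟨f, hf, rfl⟩ _ ⟨g, hg, rfl⟩
    obtain ⟨C, hC, hCE, hfC, hgC⟩ := hS.exists_circ f hf g hg
    exact ⟨π '' C, (hπ C).2 hC, image_mono hCE, mem_image_of_mem _ hfC, mem_image_of_mem _ hgC⟩

lemma IsCycleEdgeSet.inter_incidenceSet_ne [G.Loopless] {C : Set β} (hC : G.IsCycleEdgeSet C)
    (v : α) (e : β) : C ∩ G.incidenceSet v ≠ {e} := by
  intro h
  obtain ⟨P, hC⟩ := hC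
  have he : e ∈ C ∩ G.incidenceSet v := h ▸ rfl
  obtain ⟨y, hy, hyv⟩ := hC.exists_ne_mem v
  obtain ⟨P₁, F₁, P₂, F₂, p₁, p₂, -, -, hd, rfl⟩ := hC.split (hC.inc_mem he.1 he.2) hy hyv.symm
  obtain ⟨f, hf, _, -, hfv, -⟩ := p₁.exists_head hyv.symm
  obtain ⟨g, hg, _, -, hgv, -⟩ := p₂.exists_head hyv.symm
  have hfe : f ∈ ({e} : Set β) := h ▸ ⟨Or.inl hf, hfv.inc_left⟩
  have hge : g ∈ ({e} : Set β) := h ▸ ⟨Or.inr hg, hgv.inc_left⟩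
  exact Set.disjoint_left.1 hd hf (hfe.trans hge.symm ▸ hg)

/-- A bicycle has no vertex of degree one: without the edge there, it would still have more edges
than ends, and so contain a smaller bicycle. -/
lemma IsBicycle.inter_incidenceSet_ne {C : Set β} (hC : G.IsBicycle C) (v : α) (e : β) :
    C ∩ G.incidenceSet v ≠ {e} := by
  intro h
  have he : e ∈ C ∩ G.incidenceSet v := h ▸ rfl
  obtain ⟨hfin, hCE, hlt⟩ := hC.spec
  have h1 : (G.endSet (C \ {e})).ncard < (G.endSet C).ncard := by
    refine ncard_lt_ncard ⟨endSet_mono sdiff_subset, fun hsub => ?_⟩ (finite_endSet hfin)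
    obtain ⟨f, hf, hfv⟩ := hsub ⟨e, he.1, he.2⟩
    have : f ∈ ({e} : Set β) := h ▸ ⟨hf.1, hfv⟩
    exact hf.2 this
  have h2 := ncard_sdiff_singleton_add_one he.1 hfin
  obtain ⟨D, hD, hD'⟩ := exists_isBicycle_subset (hfin.subset sdiff_subset)
    (sdiff_subset.trans hCE) (show (G.endSet (C \ {e})).ncard < (C \ {e}).ncard by omega)
  have := hC.eq_of_subset hD' (hD.trans sdiff_subset)
  exact (hD (this ▸ he.1)).2 rfl

lemma IsThreeConnected.nonempty_sdiff_incidenceSet (h3 : G.IsThreeConnected) (v : α) :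
    (G.edgeSet \ G.incidenceSet v).Nonempty := by
  obtain ⟨t, ht, htv, -⟩ := h3.exists_ne v v v
  obtain ⟨e, w, he, hw, -⟩ := h3.exists_isLink_ne ht htv htv
  exact ⟨e, he.edge_mem, fun h => (Inc.eq_or_eq_of_isLink h he).elim (fun h => htv h.symm)
    fun h => hw h.symm⟩

lemma IsThreeConnected.nonempty_incidenceSet (h3 : G.IsThreeConnected) {v : α}
    (hv : v ∈ G.vertexSet) : (G.incidenceSet v).Nonempty := by
  obtain ⟨t, -, htv, -⟩ := h3.exists_ne v v v
  obtain ⟨e, w, he, -⟩ := h3.exists_isLink_ne hv htv.symm htv.symm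
  exact ⟨e, he.inc_left⟩

lemma IsThreeConnected.isConnectedFlatCompl_cycle [G.Loopless] (h3 : G.IsThreeConnected) {v : α}
    (hv : v ∈ G.vertexSet) :
    IsConnectedFlatCompl G.IsCycleEdgeSet G.edgeSet (G.incidenceSet v) := by
  refine ⟨G.incidenceSet_subset_edgeSet v, h3.nonempty_incidenceSet hv,
    h3.nonempty_sdiff_incidenceSet v, fun C hC => hC.inter_incidenceSet_ne v, fun f hf g hg => ?_⟩
  have : (G.deleteVerts {v}).Loopless := Loopless.anti deleteVerts_le
  obtain ⟨P, C, hC, hfC, hgC⟩ := (h3.isTwoConnected_deleteVerts v).exists_isCycleOn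
    (mem_edgeSet_deleteVerts_singleton.2 hf) (mem_edgeSet_deleteVerts_singleton.2 hg)
  exact ⟨C, ⟨P, hC.mono deleteVerts_le⟩,
    fun e he => mem_edgeSet_deleteVerts_singleton.1 (hC.subset_edgeSet he), hfC, hgC⟩

lemma IsThreeConnected.isConnectedFlatCompl_bicycle [G.Loopless] (h3 : G.IsThreeConnected) {v : α}
    (hv : v ∈ G.vertexSet) (hhub : ¬ G.IsHub v) :
    IsConnectedFlatCompl G.IsBicycle G.edgeSet (G.incidenceSet v) := by
  refine ⟨G.incidenceSet_subset_edgeSet v, h3.nonempty_incidenceSet hv,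
    h3.nonempty_sdiff_incidenceSet v, fun C hC => hC.inter_incidenceSet_ne v, fun f hf g hg => ?_⟩
  have : (G.deleteVerts {v}).Loopless := Loopless.anti deleteVerts_le
  obtain ⟨C, hC, hfC, hgC⟩ := (h3.isTwoConnected_deleteVerts v).exists_isTheta hhub
    (mem_edgeSet_deleteVerts_singleton.2 hf) (mem_edgeSet_deleteVerts_singleton.2 hg)
  have hCE := IsBicycle.spec (Or.inl hC)
  exact ⟨C, Or.inl (hC.mono deleteVerts_le),
    fun e he => mem_edgeSet_deleteVerts_singleton.1 (hCE.2.1 he), hfC, hgC⟩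

/-- If every vertex had an edge in the flat, the ends of an edge `e` outside the flat would lie on a
common circuit in the flat, and `e` would close a circuit with edges of that circuit. -/
lemma IsConnectedFlatCompl.exists_incidenceSet_subset {Circ : Set β → Prop} {S : Set β}
    (hS : IsConnectedFlatCompl Circ G.edgeSet S)
    (hCirc : ∀ C, Circ C → ∀ e x y, G.IsLink e x y → e ∉ C → x ∈ G.endSet C → y ∈ G.endSet C →
      ∃ D, Circ D ∧ e ∈ D ∧ D ⊆ insert e C) :
    ∃ v ∈ G.vertexSet, G.incidenceSet v ⊆ S := by
  by_contra! hcon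
  have hF : ∀ v ∈ G.vertexSet, ∃ f ∈ G.edgeSet \ S, G.Inc f v := by
    intro v hv
    obtain ⟨f, hf, hfS⟩ := not_subset.1 (hcon v hv)
    exact ⟨f, ⟨Inc.edge_mem hf, hfS⟩, hf⟩
  obtain ⟨e, he⟩ := hS.nonempty
  obtain ⟨x, y, hxy⟩ := exists_isLink_of_mem_edgeSet (hS.subset he)
  obtain ⟨f, hf, hfx⟩ := hF x hxy.left_mem
  obtain ⟨g, hg, hgy⟩ := hF y hxy.right_mem
  obtain ⟨C, hC, hCS, hfC, hgC⟩ := hS.exists_circ f hf g hg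
  obtain ⟨D, hD, heD, hDC⟩ := hCirc C hC e x y hxy (fun h => (hCS h).2 he) ⟨f, hfC, hfx⟩
    ⟨g, hgC, hgy⟩
  refine hS.inter_ne D hD e (Subset.antisymm ?_ (by simpa using ⟨heD, he⟩))
  exact fun d hd => (hDC hd.1).resolve_right fun h => (hCS h).2 hd.2

lemma IsCycleEdgeSet.exists_of_chord [G.Loopless] {C : Set β} (hC : G.IsCycleEdgeSet C) {e : β}
    {x y : α} (he : G.IsLink e x y) (heC : e ∉ C) (hx : x ∈ G.endSet C) (hy : y ∈ G.endSet C) :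
    ∃ D, G.IsCycleEdgeSet D ∧ e ∈ D ∧ D ⊆ insert e C := by
  obtain ⟨P, hC⟩ := hC
  obtain ⟨P₁, F₁, P₂, F₂, h1, -, -, -, -, rfl⟩ :=
    hC.split (endSet_eq_of_isCycleOn hC hx) (endSet_eq_of_isCycleOn hC hy) he.ne
  exact ⟨insert e F₁, ⟨P₁, x, y, F₁, e, h1, he, fun h => heC (Or.inl h), rfl⟩, Or.inl rfl,
    insert_subset_insert subset_union_left⟩

lemma IsBicycle.exists_of_chord {C : Set β} (hC : G.IsBicycle C) {e : β}
    {x y : α} (he : G.IsLink e x y) (heC : e ∉ C) (hx : x ∈ G.endSet C) (hy : y ∈ G.endSet C) :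
    ∃ D, G.IsBicycle D ∧ e ∈ D ∧ D ⊆ insert e C := by
  obtain ⟨hfin, hCE, hlt⟩ := hC.spec
  obtain ⟨f, hf, -⟩ := id hx
  -- trade `f` for `e`: the number of edges is unchanged and no end is new
  have hends : G.endSet (insert e (C \ {f})) ⊆ G.endSet C := by
    rintro v ⟨g, rfl | hg, hv⟩
    · rcases hv.eq_or_eq_of_isLink he with rfl | rfl
      exacts [hx, hy]
    · exact ⟨g, hg.1, hv⟩
  have h1 := ncard_le_ncard hends (finite_endSet hfin)
  have h2 : (insert e (C \ {f})).ncard = C.ncard := by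
    rw [ncard_insert_of_notMem (fun h => heC h.1) (hfin.subset sdiff_subset),
      ncard_sdiff_singleton_add_one hf hfin]
  obtain ⟨D, hD, hD'⟩ := exists_isBicycle_subset ((hfin.subset sdiff_subset).insert e)
    (insert_subset he.edge_mem (sdiff_subset.trans hCE)) (h1.trans_lt (h2 ▸ hlt))
  refine ⟨D, hD', ?_, hD.trans (insert_subset_insert sdiff_subset)⟩
  by_contra heD
  have hDC : D ⊆ C \ {f} := fun g hg => (hD hg).resolve_left fun h => heD (h ▸ hg)
  have := hC.eq_of_subset hD' (hDC.trans sdiff_subset)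
  exact (hDC (this ▸ hf)).2 rfl

lemma IsCycleEdgeSet.not_isBicycle_of_subset {C D : Set β} (hC : G.IsCycleEdgeSet C)
    (h : D ⊆ C) : ¬ G.IsBicycle D := by
  intro hD
  obtain ⟨P, hC⟩ := hC
  have h1 := (hC.assign.mono h (subset_univ _)).ncard_le hD.spec.1
  rw [inter_univ] at h1
  exact absurd hD.spec.2.2 (not_lt.2 h1)

/-! ### Permutations of the edges that preserve stars -/

/-- The edge permutation `π` maps the star of each vertex to the star of a vertex. -/
def PreservesStars (G : Graph α β) (π : Equiv.Perm β) : Prop :=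
  ∀ v ∈ G.vertexSet, ∃ w ∈ G.vertexSet, π '' G.incidenceSet v = G.incidenceSet w

lemma image_symm_iff {Circ : Set β → Prop} {π : Equiv.Perm β} (hπ : ∀ C, Circ (π '' C) ↔ Circ C)
    (C : Set β) : Circ (π.symm '' C) ↔ Circ C := by
  rw [← hπ, image_image]
  simp

lemma image_symm_eq {π : Equiv.Perm β} {E : Set β} (hE : π '' E = E) : π.symm '' E = E := by
  conv_lhs => rw [← hE]
  simp [image_image]

/-- Among the complements of connected flats, the stars of the vertices in `good` are the minimal
ones, so circuit-preserving permutations permute them. -/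
lemma IsThreeConnected.exists_image_incidenceSet_eq (h3 : G.IsThreeConnected)
    {Circ : Set β → Prop} {good : Set α} (hgood : good ⊆ G.vertexSet)
    (hstar : ∀ v ∈ good, IsConnectedFlatCompl Circ G.edgeSet (G.incidenceSet v))
    (hmin : ∀ S, IsConnectedFlatCompl Circ G.edgeSet S → ∃ v ∈ good, G.incidenceSet v ⊆ S)
    {π : Equiv.Perm β} (hπ : ∀ C, Circ (π '' C) ↔ Circ C) (hE : π '' G.edgeSet = G.edgeSet)
    {v : α} (hv : v ∈ good) : ∃ w ∈ good, π '' G.incidenceSet v = G.incidenceSet w := by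
  obtain ⟨w, hw, hwv⟩ := hmin _ ((hstar v hv).image hπ hE)
  obtain ⟨v', hv', hvw⟩ := hmin _ ((hstar w hw).image (image_symm_iff hπ) (image_symm_eq hE))
  have hsub : π.symm '' G.incidenceSet w ⊆ G.incidenceSet v := by
    refine (image_mono hwv).trans ?_
    simp [image_image]
  obtain rfl := h3.eq_of_incidenceSet_subset (hgood hv') (hvw.trans hsub)
  refine ⟨w, hw, Subset.antisymm ((image_mono hvw).trans ?_) hwv⟩
  simp [image_image]

/-- An edge lies in the star of `u` if and only if it does not lie in the stars of two other
vertices. -/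
lemma IsThreeConnected.map_mem_incidenceSet [G.Loopless] (h3 : G.IsThreeConnected) {u : α}
    {π : Equiv.Perm β} (hE : π '' G.edgeSet = G.edgeSet)
    (hπ : ∀ v ∈ G.vertexSet \ {u}, ∃ w ∈ G.vertexSet \ {u},
      π.symm '' G.incidenceSet v = G.incidenceSet w) {e : β} (he : e ∈ G.incidenceSet u) :
    π e ∈ G.incidenceSet u := by
  have heE : π e ∈ G.edgeSet := hE ▸ mem_image_of_mem π (G.incidenceSet_subset_edgeSet u he)
  obtain ⟨x, y, hxy⟩ := exists_isLink_of_mem_edgeSet heE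
  by_contra hcon
  have hxu : x ≠ u := fun h => hcon (h ▸ hxy.inc_left)
  have hyu : y ≠ u := fun h => hcon (h ▸ hxy.inc_right)
  obtain ⟨x', hx', hx⟩ := hπ x ⟨hxy.left_mem, hxu⟩
  obtain ⟨y', hy', hy⟩ := hπ y ⟨hxy.right_mem, hyu⟩
  have hex : e ∈ G.incidenceSet x' := hx ▸ ⟨π e, hxy.inc_left, by simp⟩
  have hey : e ∈ G.incidenceSet y' := hy ▸ ⟨π e, hxy.inc_right, by simp⟩
  have hne : x' ≠ y' := by
    rintro rfl
    exact hxy.ne (h3.eq_of_incidenceSet_subset hxy.left_mem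
      (π.symm.injective.image_injective (hx.trans hy.symm)).le)
  rcases Inc.eq_or_eq_or_eq he hex hey with h | h | h
  exacts [hx'.2 h.symm, hy'.2 h.symm, hne h]

lemma IsThreeConnected.preservesStars_of_good [G.Loopless] (h3 : G.IsThreeConnected)
    {good : Set α} (hgood : good ⊆ G.vertexSet) (hbad : (G.vertexSet \ good).Subsingleton)
    {π : Equiv.Perm β} (hE : π '' G.edgeSet = G.edgeSet)
    (hπ : ∀ v ∈ good, ∃ w ∈ good, π '' G.incidenceSet v = G.incidenceSet w)
    (hπ' : ∀ v ∈ good, ∃ w ∈ good, π.symm '' G.incidenceSet v = G.incidenceSet w) :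
    G.PreservesStars π := by
  intro u hu
  by_cases hug : u ∈ good
  · obtain ⟨w, hw, h⟩ := hπ u hug
    exact ⟨w, hgood hw, h⟩
  have heq : good = G.vertexSet \ {u} := by
    refine Subset.antisymm (fun v hv => ⟨hgood hv, fun h => hug (h ▸ hv)⟩) fun v hv => ?_
    by_contra hvg
    exact hv.2 (hbad ⟨hv.1, hvg⟩ ⟨hu, hug⟩)
  subst heq
  refine ⟨u, hu, Subset.antisymm ?_ fun e he => ?_⟩
  · rintro _ ⟨e, he, rfl⟩
    exact h3.map_mem_incidenceSet hE hπ' he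
  · exact ⟨π.symm e, h3.map_mem_incidenceSet (image_symm_eq hE) hπ he, by simp⟩

lemma IsThreeConnected.preservesStars_of_cycle [G.Loopless] (h3 : G.IsThreeConnected)
    {π : Equiv.Perm β} (hE : π '' G.edgeSet = G.edgeSet)
    (hπ : ∀ C, G.IsCycleEdgeSet (π '' C) ↔ G.IsCycleEdgeSet C) : G.PreservesStars π :=
  fun _ hv => h3.exists_image_incidenceSet_eq le_rfl (fun _ hw => h3.isConnectedFlatCompl_cycle hw)
    (fun _ hS => hS.exists_incidenceSet_subset fun _ hC _ _ _ => hC.exists_of_chord) hπ hE hv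

/-- All vertices other than the hub of a wheel are characterized by the bicircular matroid. -/
lemma IsThreeConnected.preservesStars_of_bicycle [G.Loopless] (h3 : G.IsThreeConnected)
    (h5 : 5 ≤ G.vertexSet.ncard) {π : Equiv.Perm β} (hE : π '' G.edgeSet = G.edgeSet)
    (hπ : ∀ C, G.IsBicycle (π '' C) ↔ G.IsBicycle C) : G.PreservesStars π := by
  have hmin : ∀ S, IsConnectedFlatCompl G.IsBicycle G.edgeSet S →
      ∃ v ∈ {v ∈ G.vertexSet | ¬ G.IsHub v}, G.incidenceSet v ⊆ S := by
    intro S hS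
    obtain ⟨v, hv, hvS⟩ := hS.exists_incidenceSet_subset fun C hC e x y => hC.exists_of_chord
    refine ⟨v, ⟨hv, fun hhub => ?_⟩, hvS⟩
    -- the edges outside the star of a hub form a cycle, which contains no bicycle
    obtain ⟨f, hf⟩ := hS.nonempty_sdiff
    obtain ⟨C, hC, hCS, -⟩ := hS.exists_circ f hf f hf
    obtain ⟨P, hcyc⟩ := hhub
    exact IsCycleEdgeSet.not_isBicycle_of_subset ⟨P, hcyc.mono deleteVerts_le⟩
      (fun e he => mem_edgeSet_deleteVerts_singleton.2
        ⟨(hCS he).1, fun h => (hCS he).2 (hvS h)⟩) hC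
  have key : ∀ {ρ : Equiv.Perm β}, ρ '' G.edgeSet = G.edgeSet →
      (∀ C, G.IsBicycle (ρ '' C) ↔ G.IsBicycle C) → ∀ v ∈ {v ∈ G.vertexSet | ¬ G.IsHub v},
        ∃ w ∈ {v ∈ G.vertexSet | ¬ G.IsHub v}, ρ '' G.incidenceSet v = G.incidenceSet w :=
    fun hE hρ v hv => h3.exists_image_incidenceSet_eq (fun v hv => hv.1)
      (fun v hv => h3.isConnectedFlatCompl_bicycle hv.1 hv.2) hmin hρ hE hv
  refine h3.preservesStars_of_good (fun v hv => hv.1) ?_ hE (key hE hπ)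
    (key (image_symm_eq hE) (image_symm_iff hπ))
  intro u hu w hw
  exact h3.isHub_unique h5 (not_not.1 fun h => hu.2 ⟨hu.1, h⟩) (not_not.1 fun h => hw.2 ⟨hw.1, h⟩)

/-! ### Star-preserving permutations preserve cycles and bicycles -/

lemma PreservesStars.exists_vertexMap [G.Loopless] (h3 : G.IsThreeConnected) {π : Equiv.Perm β}
    (hπ : G.PreservesStars π) : ∃ τ : α → α, InjOn τ G.vertexSet ∧
      (∀ v ∈ G.vertexSet, τ v ∈ G.vertexSet) ∧
      ∀ e x y, G.IsLink e x y → G.IsLink (π e) (τ x) (τ y) := by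
  classical
  choose! τ hτV hτ using hπ
  have hinj : InjOn τ G.vertexSet := by
    intro x hx y hy hxy
    refine h3.eq_of_incidenceSet_subset hx (π.injective.image_injective ?_).le
    rw [hτ x hx, hτ y hy, hxy]
  refine ⟨τ, hinj, hτV, fun e x y h => ?_⟩
  have hx : G.Inc (π e) (τ x) := by
    have := mem_image_of_mem π (show e ∈ G.incidenceSet x from h.inc_left)
    rwa [hτ x h.left_mem] at this
  have hy : G.Inc (π e) (τ y) := by
    have := mem_image_of_mem π (show e ∈ G.incidenceSet y from h.inc_right)
    rwa [hτ y h.right_mem] at this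
  obtain ⟨z, hz⟩ := hx
  rcases hy.eq_or_eq_of_isLink hz with h' | h'
  · exact absurd (hinj h.left_mem h.right_mem h'.symm) h.ne
  · exact h' ▸ hz

lemma IsPathBetween.image {π : Equiv.Perm β} {τ : α → α} (hinj : InjOn τ G.vertexSet)
    (hτ : ∀ v ∈ G.vertexSet, τ v ∈ G.vertexSet)
    (hlink : ∀ e x y, G.IsLink e x y → G.IsLink (π e) (τ x) (τ y)) {x y : α} {P : Set α}
    {F : Set β} (h : G.IsPathBetween x y P F) :
    G.IsPathBetween (τ x) (τ y) (τ '' P) (π '' F) := by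
  induction h with
  | nil hx => simpa using IsPathBetween.nil (hτ _ hx)
  | cons he hp hx ih =>
    rw [image_insert_eq, image_insert_eq]
    exact .cons (hlink _ _ _ he) ih fun h =>
      hx ((hinj.mem_image_iff hp.subset_vertexSet he.left_mem).1 h)

lemma PreservesStars.isCycleEdgeSet_image [G.Loopless] (h3 : G.IsThreeConnected)
    {π : Equiv.Perm β} (hπ : G.PreservesStars π) {C : Set β} (hC : G.IsCycleEdgeSet C) :
    G.IsCycleEdgeSet (π '' C) := by
  obtain ⟨τ, hinj, hτ, hlink⟩ := hπ.exists_vertexMap h3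
  obtain ⟨P, x, y, F, e, hp, he, heF, rfl⟩ := hC
  exact ⟨τ '' P, τ x, τ y, π '' F, π e, hp.image hinj hτ hlink, hlink _ _ _ he,
    fun h => heF (π.injective.mem_set_image.1 h), image_insert_eq⟩

lemma PreservesStars.exists_isBicycle_subset_image [G.Loopless] (h3 : G.IsThreeConnected)
    {π : Equiv.Perm β} (hπ : G.PreservesStars π) {C : Set β} (hC : G.IsBicycle C) :
    ∃ D ⊆ π '' C, G.IsBicycle D := by
  obtain ⟨τ, -, -, hlink⟩ := hπ.exists_vertexMap h3
  obtain ⟨hfin, hCE, hlt⟩ := hC.spec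
  have hends : G.endSet (π '' C) ⊆ τ '' G.endSet C := by
    rintro v ⟨_, ⟨e, he, rfl⟩, hv⟩
    obtain ⟨x, y, hxy⟩ := exists_isLink_of_mem_edgeSet (hCE he)
    rcases hv.eq_or_eq_of_isLink (hlink _ _ _ hxy) with rfl | rfl
    exacts [⟨x, ⟨e, he, hxy.inc_left⟩, rfl⟩, ⟨y, ⟨e, he, hxy.inc_right⟩, rfl⟩]
  refine exists_isBicycle_subset (hfin.image π) ?_ ?_
  · rintro _ ⟨e, he, rfl⟩
    obtain ⟨x, y, hxy⟩ := exists_isLink_of_mem_edgeSet (hCE he)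
    exact (hlink _ _ _ hxy).edge_mem
  · rw [ncard_image_of_injective _ π.injective]
    exact ((ncard_le_ncard hends ((finite_endSet hfin).image τ)).trans
      (ncard_image_le (finite_endSet hfin))).trans_lt hlt

lemma PreservesStars.isBicycle_image [G.Loopless] (h3 : G.IsThreeConnected)
    {π : Equiv.Perm β} (hπ : G.PreservesStars π) (hπ' : G.PreservesStars π.symm) {C : Set β}
    (hC : G.IsBicycle C) : G.IsBicycle (π '' C) := by
  obtain ⟨D, hDC, hD⟩ := hπ.exists_isBicycle_subset_image h3 hC
  obtain ⟨D', hD'D, hD'⟩ := hπ'.exists_isBicycle_subset_image h3 hD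
  have hsub : π.symm '' D ⊆ C := by
    refine (image_mono hDC).trans ?_
    simp [image_image]
  obtain rfl := hC.eq_of_subset hD' (hD'D.trans hsub)
  have : π '' D' = D := by
    refine Subset.antisymm ((image_mono hD'D).trans ?_) hDC
    simp [image_image]
  rwa [this]

lemma IsThreeConnected.image_isCycleEdgeSet_iff_image_isBicycle [G.Loopless]
    (h3 : G.IsThreeConnected) (h5 : 5 ≤ G.vertexSet.ncard) {π : Equiv.Perm β}
    (hE : π '' G.edgeSet = G.edgeSet) :
    (∀ C, G.IsCycleEdgeSet (π '' C) ↔ G.IsCycleEdgeSet C) ↔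
      ∀ C, G.IsBicycle (π '' C) ↔ G.IsBicycle C := by
  constructor <;> intro hπ
  · have h := h3.preservesStars_of_cycle hE hπ
    have h' := h3.preservesStars_of_cycle (image_symm_eq hE) (image_symm_iff hπ)
    refine fun C => ⟨fun hC => ?_, h.isBicycle_image h3 h'⟩
    simpa [image_image] using h'.isBicycle_image h3 h hC
  · have h := h3.preservesStars_of_bicycle h5 hE hπ
    have h' := h3.preservesStars_of_bicycle h5 (image_symm_eq hE) (image_symm_iff hπ)
    refine fun C => ⟨fun hC => ?_, h.isCycleEdgeSet_image h3⟩
    simpa [image_image] using h'.isCycleEdgeSet_image h3 hC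

/-! ### Automorphisms as permutations of all of `β` -/

lemma forall_subtype_image_iff {E : Set β} [DecidablePred (· ∈ E)] {Circ : Set β → Prop}
    (hCirc : ∀ C, Circ C → C ⊆ E) (σ : Equiv.Perm E) :
    (∀ C : Set E, Circ ((↑) '' (σ '' C)) ↔ Circ ((↑) '' C)) ↔
      ∀ C, Circ (Equiv.Perm.ofSubtype σ '' C) ↔ Circ C := by
  have himage : ∀ C : Set E,
      ((↑) '' (σ '' C) : Set β) = Equiv.Perm.ofSubtype σ '' ((↑) '' C) := by
    intro C
    simp [image_image]
  simp only [himage]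
  refine ⟨fun h C => ?_, fun h C => h _⟩
  by_cases hC : C ⊆ E
  · simpa [inter_eq_right.2 hC] using h ((↑) ⁻¹' C)
  · refine ⟨fun h' => absurd (fun e he => ?_) hC, fun h' => absurd (hCirc C h') hC⟩
    have := hCirc _ h' (mem_image_of_mem _ he)
    exact (Equiv.Perm.ofSubtype_apply_mem_iff_mem σ e).1 this

lemma ofSubtype_image_eq {E : Set β} [DecidablePred (· ∈ E)] (σ : Equiv.Perm E) :
    Equiv.Perm.ofSubtype σ '' E = E := by
  ext e
  rw [Equiv.image_eq_preimage_symm, mem_preimage,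
    ← Equiv.Perm.ofSubtype_apply_mem_iff_mem σ, Equiv.apply_symm_apply]

lemma IsThreeConnected.isAutomorphism_iff [G.Loopless] (h3 : G.IsThreeConnected)
    (h5 : 5 ≤ G.vertexSet.ncard) (σ : Equiv.Perm G.edgeSet) :
    G.cycleMatroid.IsAutomorphism σ ↔ G.bicircularMatroid.IsAutomorphism σ := by
  classical
  have hM : G.cycleMatroid.IsAutomorphism σ ↔
      ∀ C, G.IsCycleEdgeSet (Equiv.Perm.ofSubtype σ '' C) ↔ G.IsCycleEdgeSet C := by
    rw [← forall_subtype_image_iff (fun C ⟨P, hC⟩ => hC.subset_edgeSet)]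
    simp only [← isCircuit_cycleMatroid_iff]
    rfl
  have hB : G.bicircularMatroid.IsAutomorphism σ ↔
      ∀ C, G.IsBicycle (Equiv.Perm.ofSubtype σ '' C) ↔ G.IsBicycle C := by
    rw [← forall_subtype_image_iff (fun C hC => hC.spec.2.1)]
    simp only [← isCircuit_bicircularMatroid_iff]
    rfl
  rw [hM, hB]
  exact h3.image_isCycleEdgeSet_iff_image_isBicycle h5 (ofSubtype_image_eq σ)

end Graph

theorem theorem4p3 {α β : Type*} (G : Graph α β) [G.Loopless]
    (hV : G.vertexSet.Finite) (hE : G.edgeSet.Finite) (h5 : 5 ≤ G.vertexSet.ncard)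
    (h3 : G.IsThreeConnected) :
    G.cycleMatroid.fixingNumber = G.bicircularMatroid.fixingNumber := by
  have hfix : ∀ S : Set G.edgeSet,
      G.cycleMatroid.IsFixingSet S ↔ G.bicircularMatroid.IsFixingSet S :=
    fun S => forall_congr' fun σ => imp_congr_left (h3.isAutomorphism_iff h5 σ)
  exact congrArg sInf (Set.ext fun r => exists_congr fun S => and_congr_left' (hfix S))
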